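/- Let $p$ be an odd prime and let $F$ be a finite field (for instance $F=\mathbb{Z}/p\mathbb{Z}$). Graphs are finite, undirected, without loops and without multiple edges. For a graph $\Gamma$ with vertex set $V$, the H-algebra $R^0(\Gamma)$ is the Lie algebra over $\mathbb{Z}/p^3\mathbb{Z}$ with generators $v_i$ and $a_{ij}$ ($i,j\in V$) and the defining relations $[v_i,v_j]=a_{ij}$, $[a_{ij},v_k]=[a_{ij},a_{kl}]=0$, $p\,a_{ij}=0$ if $i,j$ are adjacent, and $p^2a_{ij}=0$ otherwise. The H-group $G(\Gamma)$ is the group with generators $g_i$ and $a_{ij}$ ($i,j\in V$) and the defining relations $[g_i,g_j]=a_{ij}$, $[a_{ij},g_k]=[a_{ij},a_{kl}]=1$, $g_i^{p^3}=1$, $a_{ij}^{p}=1$ if $i,j$ are adjacent, and $a_{ij}^{p^2}=1$ otherwise. Pairs $(A,B)$ and $(A',B')$ of square matrices over $F$ are similar if they have the same size and $(A',B')=(SAS^{-1},SBS^{-1})$ for some invertible matrix $S$. A uniform graph construction over $F$ is given by integers $t,k,r\ge 0$, an $r\times 2k$ matrix $\mathcal{T}$ of non-commutative polynomials over $F$ in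 two variables, and a ternary relation $\rho\subseteq\{1,\dots,t\}^2\times 2^{\{1,\dots,r\}}$; none of these depends on the size of the matrices to which the construction is applied. It attaches to every $n\geq 0$ and every pair $(A,B)$ of $n\times n$ matrices over $F$ the finite graph $\Gamma_{\mathcal{T}}(A,B)$ whose vertices are the pairs $(s,x)$ with $s\in\{1,\dots,t\}$ and $x\in(F^n)^k$, where two distinct vertices $(s,x)$, $(s',y)$ are adjacent if and only if $\rho(s,s',J(x,y))$ or $\rho(s',s,J(y,x))$ holds. Here $J(x,y)$ is the set of those $j$ for which the $j$-th block row of $\mathcal{T}(A,B)$ annihilates the column $(x_1,\dots,x_k,y_1,\dots,y_k)$. Then the problems of classifying graphs, H-algebras over $\mathbb{Z}/p^3\mathbb{Z}$ and H-groups up to isomorphism are wild, that is, each of them contains the problem of classifying pairs of matrices over $F$ up to simultaneous similarity, in the following sense. 1. There is a uniform graph construction over $F$ such that any two pairs $(A,B)$, $(A',B')$ of square matrices over $F$, of any sizes, are similar if and only if $\Gamma_{\mathcal{T}}(A,B)\cong\Gamma_{\mathcal{T}}(A',B')$. 2. There is a uniform graph construction over $F$ such that any two pairs $(A,B)$, $(A',B')$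 are similar if and only if $R^0(\Gamma_{\mathcal{T}}(A,B))\cong R^0(\Gamma_{\mathcal{T}}(A',B'))$ as Lie algebras over $\mathbb{Z}/p^3\mathbb{Z}$. 3. There is a uniform graph construction over $F$ such that any two pairs $(A,B)$, $(A',B')$ are similar if and only if $G(\Gamma_{\mathcal{T}}(A,B))\cong G(\Gamma_{\mathcal{T}}(A',B'))$ as groups. -/

import Mathlib

universe u

/-! ## Finite graphs, their H-algebras and their H-groups -/

/-- A finite undirected graph without loops and without multiple edges. -/
structure FinGraph : Type (u + 1) where
  V : Type u
  finite : Finite V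
  graph : SimpleGraph V

namespace FinGraph

/-- The graphs `Γ` and `Δ` are isomorphic. -/
def GraphIso (Γ Δ : FinGraph.{u}) : Prop :=
  Nonempty (Γ.graph ≃g Δ.graph)

/-- Generators: the vertex variables `v i` and the pair variables `a i j`. -/
inductive Gen (V : Type u) : Type u
  | v (i : V) : Gen V
  | a (i j : V) : Gen V

section HAlgebra

variable (p : ℕ) (Γ : FinGraph.{u})

/-- The free Lie algebra over `ℤ/p³` on the variables `v i`, `a i j`. -/
abbrev FreeLie : Type u := FreeLieAlgebra (ZMod (p ^ 3)) (Gen Γ.V)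

/-- The variable `v i` in the free Lie algebra. -/
noncomputable def lieV (i : Γ.V) : FreeLie p Γ := FreeLieAlgebra.of (ZMod (p ^ 3)) (Gen.v i)

/-- The variable `a i j` in the free Lie algebra. -/
noncomputable def lieA (i j : Γ.V) : FreeLie p Γ := FreeLieAlgebra.of (ZMod (p ^ 3)) (Gen.a i j)

/-- The defining relators of the H-algebra. -/
inductive LieRelator : FreeLie p Γ → Prop
  | product (i j : Γ.V) : LieRelator (⁅lieV p Γ i, lieV p Γ j⁆ - lieA p Γ i j)
  | central_v (i j k : Γ.V) : LieRelator ⁅lieA p Γ i j, lieV p Γ k⁆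
  | central_a (i j k l : Γ.V) : LieRelator ⁅lieA p Γ i j, lieA p Γ k l⁆
  | edge (i j : Γ.V) : Γ.graph.Adj i j → LieRelator ((p : ZMod (p ^ 3)) • lieA p Γ i j)
  | nonedge (i j : Γ.V) : ¬ Γ.graph.Adj i j →
      LieRelator ((p ^ 2 : ZMod (p ^ 3)) • lieA p Γ i j)

/-- The ideal of relations of the H-algebra. -/
noncomputable def lieIdeal : LieIdeal (ZMod (p ^ 3)) (FreeLie p Γ) :=
  LieSubmodule.lieSpan (ZMod (p ^ 3)) (FreeLie p Γ) {x | LieRelator p Γ x}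

/-- The generalized Heisenberg algebra (H-algebra) of the graph `Γ`, a Lie algebra over `ℤ/p³`. -/
abbrev HAlgebra : Type u := FreeLie p Γ ⧸ lieIdeal p Γ

end HAlgebra

/-- The H-algebras of `Γ` and `Δ` are isomorphic as Lie algebras over `ℤ/p³`. -/
def HAlgebraIso (p : ℕ) (Γ Δ : FinGraph.{u}) : Prop :=
  Nonempty (HAlgebra p Γ ≃ₗ⁅ZMod (p ^ 3)⁆ HAlgebra p Δ)

section HGroup

open scoped commutatorElement

variable (p : ℕ) (Γ : FinGraph.{u})

/-- The generator `g i` in the free group. -/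
def grpG (i : Γ.V) : FreeGroup (Gen Γ.V) := FreeGroup.of (Gen.v i)

/-- The generator `a i j` in the free group. -/
def grpA (i j : Γ.V) : FreeGroup (Gen Γ.V) := FreeGroup.of (Gen.a i j)

/-- The defining relators of the H-group. -/
inductive GroupRelator : FreeGroup (Gen Γ.V) → Prop
  | commutator (i j : Γ.V) : GroupRelator (⁅grpG Γ i, grpG Γ j⁆ * (grpA Γ i j)⁻¹)
  | central_g (i j k : Γ.V) : GroupRelator ⁅grpA Γ i j, grpG Γ k⁆
  | central_a (i j k l : Γ.V) : GroupRelator ⁅grpA Γ i j, grpA Γ k l⁆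
  | vertex (i : Γ.V) : GroupRelator (grpG Γ i ^ p ^ 3)
  | edge (i j : Γ.V) : Γ.graph.Adj i j → GroupRelator (grpA Γ i j ^ p)
  | nonedge (i j : Γ.V) : ¬ Γ.graph.Adj i j → GroupRelator (grpA Γ i j ^ p ^ 2)

/-- The H-group of the graph `Γ`. -/
abbrev HGroup : Type u := PresentedGroup {x | GroupRelator p Γ x}

end HGroup

/-- The H-groups of `Γ` and `Δ` are isomorphic. -/
def HGroupIso (p : ℕ) (Γ Δ : FinGraph.{u}) : Prop :=
  Nonempty (HGroup p Γ ≃* HGroup p Δ)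

end FinGraph

/-! ## Pairs of matrices up to simultaneous similarity -/

/-- A pair of square matrices over `F` of the same size `n`. -/
structure MatrixPair (F : Type u) : Type u where
  n : ℕ
  A : Matrix (Fin n) (Fin n) F
  B : Matrix (Fin n) (Fin n) F

/-- Simultaneous similarity, `(A', B') = S (A, B) S⁻¹`; `S'` is the inverse of `S`.
Over a field this forces the two pairs to have the same size. -/
def MatrixPair.Similar {F : Type u} [Field F] (P Q : MatrixPair F) : Prop :=
  ∃ (S : Matrix (Fin Q.n) (Fin P.n) F) (S' : Matrix (Fin P.n) (Fin Q.n) F),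
    S * S' = 1 ∧ S' * S = 1 ∧ Q.A = S * P.A * S' ∧ Q.B = S * P.B * S'

/-- The value `f(A, B)` of a non-commutative polynomial `f` at a pair of matrices. -/
noncomputable def MatrixPair.eval {F : Type u} [Field F] (P : MatrixPair F)
    (f : FreeAlgebra F (Fin 2)) : Matrix (Fin P.n) (Fin P.n) F :=
  FreeAlgebra.lift F ![P.A, P.B] f

/-! ## Containment of the pair problem -/

/-- A uniform construction of finite graphs from pairs of matrices. It consists of an
`r × 2k` matrix of non-commutative polynomials in two variables, and of a rule `adj`
on a set of `t` colours. None of these data depends on the size of the matrices. -/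
structure GraphScheme (F : Type u) [Field F] : Type u where
  t : ℕ
  k : ℕ
  r : ℕ
  T : Matrix (Fin r) (Fin k ⊕ Fin k) (FreeAlgebra F (Fin 2))
  adj : Fin t → Fin t → Set (Fin r) → Prop

namespace GraphScheme

variable {F : Type u} [Field F] (𝒯 : GraphScheme F)

/-- The vertices: `k`-tuples of vectors of `Fⁿ`, with a colour. -/
abbrev Vertex (n : ℕ) : Type u := Fin 𝒯.t × (Fin 𝒯.k → Fin n → F)

/-- The set of rows of the block matrix `T(A, B)` that annihilate the column of vectors
`(x₁, …, x_k, y₁, …, y_k)`. -/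
def vanishing (P : MatrixPair F) (x y : Fin 𝒯.k → Fin P.n → F) : Set (Fin 𝒯.r) :=
  {j | ∑ c, (P.eval (𝒯.T j c)).mulVec (Sum.elim x y c) = 0}

/-- The finite graph constructed from a pair of matrices: whether two distinct vertices
`(s, x)` and `(s', y)` are joined depends only on their colours and on which rows of
`T(A, B)` annihilate `(x, y)`. -/
def graph [Finite F] (P : MatrixPair F) : FinGraph.{u} where
  V := 𝒯.Vertex P.n
  finite := inferInstance
  graph := SimpleGraph.fromRel fun v w => 𝒯.adj v.1 w.1 (𝒯.vanishing P v.2 w.2)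

end GraphScheme

/-- The problem of classifying, up to isomorphism, objects that are attached to finite graphs
(`Iso Γ Δ` says that the objects attached to `Γ` and `Δ` are isomorphic) is wild over `F`: it
contains the problem of classifying pairs of matrices over `F` up to simultaneous similarity. -/
def IsWild (F : Type u) [Field F] [Finite F] (Iso : FinGraph.{u} → FinGraph.{u} → Prop) : Prop :=
  ∃ 𝒯 : GraphScheme F, ∀ P Q : MatrixPair F, P.Similar Q ↔ Iso (𝒯.graph P) (𝒯.graph Q)

/-! One construction serves all three problems. It yields graphs that determine the matrix pair up
to similarity and in which no two adjacent vertices are twins; for such graphs, the H-algebra and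
the H-group determine the graph.

For the second point, map the H-algebra or H-group into a Heisenberg object over `ZMod (p ^ 3)`
whose commutator is `p` times a 2×2 determinant. The relation at a non-edge then holds
automatically, and the relation at an edge says that the determinant vanishes mod `p`. So such maps
amount to pairs of vectors that are proportional mod `p` along every edge, up to central coordinates
of the generator images. An isomorphism induces an invertible matrix on abelianizations, hence a
linear bijection over the field with `p` elements that respects `EdgeParallel` both ways. By
`nonempty_iso_of_edgeParallel` this forces a graph isomorphism: dimensions of `parallelSpace` count
non-neighbours, and a nonzero term of the determinant supplies the vertex bijection.

For the first point, `layered` encodes finitely many binary relations on the set of pairs of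
vectors. They express addition, scalar multiplication and the action of the two matrices, so a
bijection preserving them is a linear similarity (`exists_equiv_of_layered_iso`,
`similar_of_equiv`). -/

/-! ### Recovering a graph from proportionality along edges. -/

namespace SimpleGraph

/-- The vectors `x` and `y` are proportional along every edge of `G`. -/
def EdgeParallel {V A : Type*} [CommRing A] (G : SimpleGraph V) (x y : V → A) : Prop :=
  ∀ i j, G.Adj i j → x i * y j = x j * y i

/-- The space of vectors that are proportional to `x` along every edge of `G`. -/
def parallelSpace {V K : Type*} [Field K] (G : SimpleGraph V) (x : V → K) :
    Submodule K (V → K) where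
  carrier := {y | G.EdgeParallel x y}
  zero_mem' := fun i j _ => by simp
  add_mem' := fun {y z} hy hz i j hij => by
    simp only [Pi.add_apply, mul_add, hy i j hij, hz i j hij]
  smul_mem' := fun c y hy i j hij => by
    simp only [Pi.smul_apply, smul_eq_mul]
    linear_combination c * hy i j hij

/-- No two adjacent vertices have the same neighbours. -/
def NoAdjTwins {V : Type*} (G : SimpleGraph V) : Prop :=
  ∀ j l, G.Adj j l → ∃ m, m ≠ j ∧ m ≠ l ∧ ¬ (G.Adj j m ↔ G.Adj l m)

section Field

variable {V W K : Type*} [Field K]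

/-- Restriction to the non-neighbours of `j`. -/
def restrictNonNeighbors (G : SimpleGraph V) (x : V → K) (j : V) :
    G.parallelSpace x →ₗ[K] ({m // ¬ G.Adj j m} → K) :=
  (LinearMap.funLeft K K Subtype.val).domRestrict (G.parallelSpace x)

/-- Along an edge from `j` to `m` the condition `x j * y m = x m * y j` determines `y m` from `y j`,
and `j` counts among its own non-neighbours. -/
theorem restrictNonNeighbors_injective (G : SimpleGraph V) {x : V → K} {j : V} (hx : x j ≠ 0) :
    Function.Injective (G.restrictNonNeighbors x j) := by
  rw [injective_iff_map_eq_zero]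
  rintro ⟨y, hy⟩ h
  have h0 : ∀ m, ¬ G.Adj j m → y m = 0 := fun m hm => congrFun h ⟨m, hm⟩
  ext m
  by_cases hm : G.Adj j m
  · have := hy j m hm
    rw [h0 j (G.irrefl), mul_zero] at this
    simpa [hx] using this
  · exact h0 m hm

variable [Finite V]

theorem finrank_nonNeighbors (G : SimpleGraph V) (j : V) :
    Module.finrank K ({m // ¬ G.Adj j m} → K) = Nat.card {m // ¬ G.Adj j m} := by
  have := Fintype.ofFinite {m // ¬ G.Adj j m}
  rw [Module.finrank_fintype_fun_eq_card, Nat.card_eq_fintype_card]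

theorem finrank_parallelSpace_le (G : SimpleGraph V) {x : V → K} {j : V} (hx : x j ≠ 0) :
    Module.finrank K (G.parallelSpace x) ≤ Nat.card {m // ¬ G.Adj j m} := by
  rw [← finrank_nonNeighbors (K := K)]
  exact LinearMap.finrank_le_finrank_of_injective (G.restrictNonNeighbors_injective hx)

/-- For a basis vector only the edges at `i` impose conditions, namely that `y` vanishes on the
neighbours of `i`; the other values are free. Basis vectors thus attain the upper bound of
`finrank_parallelSpace_le`. -/
theorem le_finrank_parallelSpace_single [DecidableEq V] (G : SimpleGraph V) (i : V) :
    Nat.card {m // ¬ G.Adj i m} ≤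
      Module.finrank K (G.parallelSpace (Pi.single i (1 : K))) := by
  classical
  rw [← finrank_nonNeighbors (K := K)]
  apply LinearMap.finrank_le_finrank_of_surjective
    (f := G.restrictNonNeighbors (Pi.single i (1 : K)) i)
  intro g
  refine ⟨⟨fun m => if h : ¬ G.Adj i m then g ⟨m, h⟩ else 0, ?_⟩, ?_⟩
  · intro a b hab
    by_cases ha : a = i
    · subst ha
      simp [hab, hab.ne']
    · by_cases hb : b = i
      · subst hb
        simp [hab.symm, hab.ne]
      · simp [ha, hb]
  · ext ⟨m, hm⟩
    simp [restrictNonNeighbors, LinearMap.funLeft_apply, hm]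

/-- In the extremal case restriction is also surjective, so some `y` in the space equals 1 at `m`
and 0 at all other non-neighbours of `j`. Since `y j = 0`, it vanishes on the neighbours of `j` too,
and the edge from `m` to `s` leaves `x s = 0`. -/
theorem eq_zero_of_finrank_le (G : SimpleGraph V) {x : V → K} {j : V} (hx : x j ≠ 0)
    (hr : Nat.card {m // ¬ G.Adj j m} ≤ Module.finrank K (G.parallelSpace x))
    {m s : V} (hm : ¬ G.Adj j m) (hmj : m ≠ j) (hs : G.Adj m s) : x s = 0 := by
  classical
  have hinj := G.restrictNonNeighbors_injective hx
  have heq : Module.finrank K (G.parallelSpace x) =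
      Module.finrank K ({m // ¬ G.Adj j m} → K) := by
    rw [finrank_nonNeighbors]
    exact le_antisymm (G.finrank_parallelSpace_le hx) hr
  obtain ⟨⟨y, hy⟩, hym⟩ :=
    (LinearMap.injective_iff_surjective_of_finrank_eq_finrank heq).1 hinj
      (fun k => if k.1 = m then 1 else 0)
  have h0 : ∀ k, ¬ G.Adj j k → y k = if k = m then 1 else 0 := fun k hk => congrFun hym ⟨k, hk⟩
  have hyj : y j = 0 := by rw [h0 j G.irrefl, if_neg hmj.symm]
  have hys : y s = 0 := by
    by_cases hjs : G.Adj j s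
    · have := hy j s hjs
      rw [hyj, mul_zero] at this
      simpa [hx] using this
    · rw [h0 s hjs, if_neg hs.ne']
  have := hy m s hs
  rw [hys, h0 m hm, if_pos rfl] at this
  simpa using this.symm

theorem finrank_parallelSpace_le_map {V W : Type*} [Finite W] (G : SimpleGraph V)
    (H : SimpleGraph W)
    (φ : (V → K) ≃ₗ[K] (W → K))
    (h : ∀ x y, G.EdgeParallel x y → H.EdgeParallel (φ x) (φ y)) (x : V → K) :
    Module.finrank K (G.parallelSpace x) ≤ Module.finrank K (H.parallelSpace (φ x)) := by
  rw [← LinearEquiv.finrank_map_eq φ]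
  apply Submodule.finrank_mono
  rintro _ ⟨y, hy, rfl⟩
  exact h x y hy

variable [Finite W]

/-- The non-vanishing of the determinant gives a non-vanishing generalized diagonal. -/
theorem _root_.LinearEquiv.exists_diagonal_ne_zero [DecidableEq V]
    (φ : (V → K) ≃ₗ[K] (W → K)) :
    ∃ σ : V ≃ W, ∀ i, φ (Pi.single i 1) (σ i) ≠ 0 := by
  have := Fintype.ofFinite V
  have := Fintype.ofFinite W
  have hc : Fintype.card V = Fintype.card W := by
    simpa [Module.finrank_fintype_fun_eq_card] using φ.finrank_eq
  let e : V ≃ W := Fintype.equivOfCardEq hc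
  let ψ : (V → K) ≃ₗ[K] (V → K) := φ.trans (LinearEquiv.funCongrLeft K K e)
  have hdet : (LinearMap.toMatrix' (ψ : (V → K) →ₗ[K] (V → K))).det ≠ 0 := by
    rw [LinearMap.det_toMatrix']
    exact (LinearEquiv.isUnit_det' ψ).ne_zero
  rw [Matrix.det_apply] at hdet
  obtain ⟨s, -, hs⟩ := Finset.exists_ne_zero_of_sum_ne_zero hdet
  refine ⟨s.trans e, fun i hi => hs ?_⟩
  rw [Finset.prod_eq_zero (Finset.mem_univ i), smul_zero]
  rw [LinearMap.toMatrix'_apply]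
  exact hi

theorem card_nonNeighbors_le (G : SimpleGraph V) (H : SimpleGraph W) [DecidableEq V]
    (φ : (V → K) ≃ₗ[K] (W → K))
    (h : ∀ x y, G.EdgeParallel x y → H.EdgeParallel (φ x) (φ y)) {i : V} {j : W}
    (hij : φ (Pi.single i 1) j ≠ 0) :
    Nat.card {m // ¬ G.Adj i m} ≤ Nat.card {m // ¬ H.Adj j m} :=
  (G.le_finrank_parallelSpace_single (K := K) i).trans
    ((finrank_parallelSpace_le_map G H φ h _).trans (H.finrank_parallelSpace_le hij))

/-- The inequality holds termwise along `σ`. A second bijection, taken from the inverse map and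
unrelated to `σ`, gives the reverse inequality for the sums, so every term is an equality. -/
theorem card_nonNeighbors_eq (G : SimpleGraph V) (H : SimpleGraph W) [DecidableEq V]
    (φ : (V → K) ≃ₗ[K] (W → K))
    (h : ∀ x y, G.EdgeParallel x y ↔ H.EdgeParallel (φ x) (φ y)) (σ : V ≃ W)
    (hσ : ∀ i, φ (Pi.single i 1) (σ i) ≠ 0) (i : V) :
    Nat.card {m // ¬ G.Adj i m} = Nat.card {m // ¬ H.Adj (σ i) m} := by
  classical
  have := Fintype.ofFinite V
  have := Fintype.ofFinite W
  have hle : ∀ i, Nat.card {m // ¬ G.Adj i m} ≤ Nat.card {m // ¬ H.Adj (σ i) m} := fun i =>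
    card_nonNeighbors_le G H φ (fun x y => (h x y).1) (hσ i)
  obtain ⟨τ, hτ⟩ := φ.symm.exists_diagonal_ne_zero
  have hle' : ∀ j, Nat.card {m // ¬ H.Adj j m} ≤ Nat.card {m // ¬ G.Adj (τ j) m} := fun j =>
    card_nonNeighbors_le H G φ.symm
      (fun x y hxy => (h _ _).2 (by simpa using hxy)) (hτ j)
  have hsum : ∑ i, Nat.card {m // ¬ G.Adj i m} = ∑ i, Nat.card {m // ¬ H.Adj (σ i) m} := by
    apply le_antisymm (Finset.sum_le_sum fun i _ => hle i)
    calc ∑ i, Nat.card {m // ¬ H.Adj (σ i) m} = ∑ j, Nat.card {m // ¬ H.Adj j m} :=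
          Equiv.sum_comp σ (fun j => Nat.card {m // ¬ H.Adj j m})
      _ ≤ ∑ j, Nat.card {m // ¬ G.Adj (τ j) m} := Finset.sum_le_sum fun j _ => hle' j
      _ = ∑ i, Nat.card {m // ¬ G.Adj i m} :=
          Equiv.sum_comp τ (fun j => Nat.card {m // ¬ G.Adj j m})
  exact (Finset.sum_eq_sum_iff_of_le fun i _ => hle i).1 hsum i (Finset.mem_univ i)

/-- A graph without adjacent twins is determined by the relation of being proportional along
every edge. -/
theorem nonempty_iso_of_edgeParallel (G : SimpleGraph V) (H : SimpleGraph W)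
    (hH : H.NoAdjTwins) (φ : (V → K) ≃ₗ[K] (W → K))
    (h : ∀ x y, G.EdgeParallel x y ↔ H.EdgeParallel (φ x) (φ y)) : Nonempty (G ≃g H) := by
  classical
  obtain ⟨σ, hσ⟩ := φ.exists_diagonal_ne_zero
  have hcard := card_nonNeighbors_eq G H φ h σ hσ
  have hrank : ∀ i, Nat.card {m // ¬ G.Adj i m} ≤
      Module.finrank K (H.parallelSpace (φ (Pi.single i 1))) := fun i =>
    (G.le_finrank_parallelSpace_single (K := K) i).trans
      (finrank_parallelSpace_le_map G H φ (fun x y => (h x y).1) _)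
  have hadj : ∀ i k, ¬ G.Adj i k → ¬ H.Adj (σ i) (σ k) := by
    intro i k hik hσik
    -- The determinant of two basis vectors at an edge can be nonzero only if that edge joins `i`
    -- and `k`.
    have hpar : G.EdgeParallel (Pi.single i (1 : K)) (Pi.single k 1) := by
      intro a b hab
      by_cases ha : a = i
      · by_cases hb : b = k
        · exact absurd (ha ▸ hb ▸ hab) hik
        · rcases eq_or_ne b i with rfl | hbi
          · exact absurd ha hab.ne
          · simp [hb, hbi]
      · by_cases hb : b = i
        · have hak : a ≠ k := by
            rintro rfl
            exact hik (hb ▸ hab.symm)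
          simp [ha, hak]
        · simp [ha, hb]
    have hprod := (h _ _).1 hpar _ _ hσik
    -- Proportionality along the edge from `σ i` to `σ k` equates the product of the diagonal
    -- entries with that of the off-diagonal ones.
    have hne : φ (Pi.single i 1) (σ k) ≠ 0 ∧ φ (Pi.single k 1) (σ i) ≠ 0 := by
      rw [← mul_ne_zero_iff, ← hprod]
      exact mul_ne_zero (hσ i) (hσ k)
    have h1 := (hcard i).symm.le.trans (hrank i)
    -- The off-diagonal entry of the image of the `k`-th basis vector compares the counts at `k` and
    -- `i`, so the image of the `i`-th one is extremal at `σ k` as well as at `σ i`. A vertex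
    -- separating these two then makes one of its nonzero entries vanish.
    have h2 : Nat.card {m // ¬ H.Adj (σ k) m} ≤
        Module.finrank K (H.parallelSpace (φ (Pi.single i 1))) := by
      have := (hrank k).trans (H.finrank_parallelSpace_le hne.2)
      rw [← hcard i] at this
      exact (hcard k).symm.le.trans (this.trans (hrank i))
    obtain ⟨m, hmi, hmk, hm⟩ := hH _ _ hσik
    refine hm ⟨fun h' => ?_, fun h' => ?_⟩
    · by_contra hkm
      exact hσ i (H.eq_zero_of_finrank_le hne.1 h2 hkm hmk h'.symm)
    · by_contra him
      exact hne.1 (H.eq_zero_of_finrank_le (hσ i) h1 him hmi h'.symm)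
  refine ⟨⟨σ, @fun i k => ?_⟩⟩
  refine ⟨fun hik => by_contra fun hn => hadj i k hn hik, fun hik => by_contra fun hn => ?_⟩
  -- Equal counts turn this injection into a bijection, which excludes an edge being sent to a
  -- non-edge.
  let g : {m // ¬ G.Adj i m} → {m // ¬ H.Adj (σ i) m} := fun m => ⟨σ m, hadj i m m.2⟩
  have hg : Function.Injective g := fun a b hab =>
    Subtype.ext (σ.injective (congrArg Subtype.val hab))
  obtain ⟨⟨m, hm⟩, hmk⟩ :=
    (Nat.bijective_iff_injective_and_card g).2 ⟨hg, hcard i⟩ |>.2 ⟨σ k, hn⟩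
  have : m = k := σ.injective (congrArg Subtype.val hmk)
  exact hm (this ▸ hik)

/-- Isomorphisms produce matrices over `ZMod (p ^ 3)`, while the combinatorics needs a field; this
reduces the matrices along `π` and lifts vectors back. -/
theorem nonempty_iso_of_matrix {A : Type*} [CommRing A] (G : SimpleGraph V) (H : SimpleGraph W)
    [Fintype V] [Fintype W] [DecidableEq V] [DecidableEq W]
    (hH : H.NoAdjTwins) (π : A →+* K) (hπ : Function.Surjective π)
    (M : Matrix W V A) (N : Matrix V W A) (hMN : M * N = 1) (hNM : N * M = 1)
    (hM : ∀ x y : W → A, H.EdgeParallel (π ∘ x) (π ∘ y) →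
      G.EdgeParallel (π ∘ Matrix.vecMul x M) (π ∘ Matrix.vecMul y M))
    (hN : ∀ x y : V → A, G.EdgeParallel (π ∘ x) (π ∘ y) →
      H.EdgeParallel (π ∘ Matrix.vecMul x N) (π ∘ Matrix.vecMul y N)) :
    Nonempty (G ≃g H) := by
  have hMN' : M.map π * N.map π = 1 := by
    rw [← Matrix.map_mul, hMN, Matrix.map_one _ π.map_zero π.map_one]
  have hNM' : N.map π * M.map π = 1 := by
    rw [← Matrix.map_mul, hNM, Matrix.map_one _ π.map_zero π.map_one]
  let φ : (V → K) ≃ₗ[K] (W → K) :=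
    LinearEquiv.ofLinearMap (N.map π).vecMulLinear (M.map π).vecMulLinear
      (LinearMap.ext fun x => by simp [Matrix.vecMul_vecMul, hMN'])
      (LinearMap.ext fun x => by simp [Matrix.vecMul_vecMul, hNM'])
  have hM' : ∀ x y : W → K, H.EdgeParallel x y → G.EdgeParallel (φ.symm x) (φ.symm y) := by
    intro x y hxy
    obtain ⟨x, rfl⟩ := hπ.comp_left x
    obtain ⟨y, rfl⟩ := hπ.comp_left y
    have h : ∀ z : W → A, φ.symm (π ∘ z) = π ∘ Matrix.vecMul z M := fun z =>
      funext fun i => (RingHom.map_vecMul π M z i).symm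
    simpa only [h] using hM x y hxy
  have hN' : ∀ x y : V → K, G.EdgeParallel x y → H.EdgeParallel (φ x) (φ y) := by
    intro x y hxy
    obtain ⟨x, rfl⟩ := hπ.comp_left x
    obtain ⟨y, rfl⟩ := hπ.comp_left y
    have h : ∀ z : V → A, φ (π ∘ z) = π ∘ Matrix.vecMul z N := fun z =>
      funext fun i => (RingHom.map_vecMul π N z i).symm
    simpa only [h] using hN x y hxy
  exact nonempty_iso_of_edgeParallel G H hH φ fun x y =>
    ⟨hN' x y, fun h => by simpa using hM' _ _ h⟩

end Field

end SimpleGraph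

/-! ### H-algebras and their maps into a Heisenberg Lie algebra. -/

theorem ZMod.sq_mul_eq_zero_iff {p : ℕ} (hp : p.Prime) (a : ZMod (p ^ 3)) :
    (p : ZMod (p ^ 3)) ^ 2 * a = 0 ↔
      ZMod.castHom (Dvd.intro_left (p ^ 2) rfl : p ∣ p ^ 3) (ZMod p) a = 0 := by
  have : NeZero (p ^ 3) := ⟨pow_ne_zero 3 hp.ne_zero⟩
  obtain ⟨n, rfl⟩ := ZMod.natCast_zmod_surjective a
  rw [map_natCast, ZMod.natCast_eq_zero_iff, ← Nat.cast_pow, ← Nat.cast_mul,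
    ZMod.natCast_eq_zero_iff, pow_succ, mul_dvd_mul_iff_left (pow_ne_zero 2 hp.ne_zero)]

namespace FinGraph

section Lie

variable {p : ℕ} {Γ Δ : FinGraph.{u}}

/-- The family `x` satisfies the relations imposed on the vertices of the H-algebra of `Γ`. -/
structure LieAdmissible (p : ℕ) (Γ : FinGraph.{u}) {L : Type*} [LieRing L]
    [LieAlgebra (ZMod (p ^ 3)) L] (x : Γ.V → L) : Prop where
  central : ∀ i j k, ⁅⁅x i, x j⁆, x k⁆ = 0
  edge : ∀ i j, Γ.graph.Adj i j → (p : ZMod (p ^ 3)) • ⁅x i, x j⁆ = 0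
  nonedge : ∀ i j, ¬ Γ.graph.Adj i j → (p ^ 2 : ZMod (p ^ 3)) • ⁅x i, x j⁆ = 0

namespace HAlgebra

/-- The generator of the H-algebra at a vertex. -/
noncomputable def v (i : Γ.V) : HAlgebra p Γ := LieSubmodule.Quotient.mk (lieV p Γ i)

theorem mk_eq_zero_of_relator {x : FreeLie p Γ} (hx : LieRelator p Γ x) :
    (LieSubmodule.Quotient.mk x : HAlgebra p Γ) = 0 :=
  LieSubmodule.Quotient.mk_eq_zero'.2 (LieSubmodule.subset_lieSpan hx)

theorem mk_lieA (i j : Γ.V) :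
    (LieSubmodule.Quotient.mk (lieA p Γ i j) : HAlgebra p Γ) = ⁅(v i : HAlgebra p Γ), (v j : HAlgebra p Γ)⁆ := by
  have h := mk_eq_zero_of_relator (LieRelator.product (p := p) i j)
  have h' : (LieSubmodule.Quotient.mk ⁅lieV p Γ i, lieV p Γ j⁆ : HAlgebra p Γ) -
      LieSubmodule.Quotient.mk (lieA p Γ i j) = 0 := h
  rw [sub_eq_zero, LieSubmodule.Quotient.mk_bracket] at h'
  exact h'.symm

theorem lieAdmissible_v : LieAdmissible p Γ (v (p := p)) where
  central i j k := by
    have h := mk_eq_zero_of_relator (LieRelator.central_v (p := p) i j k)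
    rwa [LieSubmodule.Quotient.mk_bracket, mk_lieA] at h
  edge i j hij := by
    rw [← mk_lieA]
    exact mk_eq_zero_of_relator (LieRelator.edge (p := p) i j hij)
  nonedge i j hij := by
    rw [← mk_lieA]
    exact mk_eq_zero_of_relator (LieRelator.nonedge (p := p) i j hij)

variable {L : Type*} [LieRing L] [LieAlgebra (ZMod (p ^ 3)) L]

theorem hom_ext {f g : HAlgebra p Γ →ₗ⁅ZMod (p ^ 3)⁆ L} (h : ∀ i, f (v i) = g (v i)) :
    f = g := by
  let q : FreeLie p Γ →ₗ⁅ZMod (p ^ 3)⁆ HAlgebra p Γ :=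
    { (lieIdeal p Γ).toSubmodule.mkQ with
      map_lie' := fun {x y} => LieSubmodule.Quotient.mk_bracket (lieIdeal p Γ) x y }
  have hq : f.comp q = g.comp q := by
    refine FreeLieAlgebra.hom_ext fun x => ?_
    cases x with
    | v i => exact h i
    | a i j =>
      have hm : q (FreeLieAlgebra.of (ZMod (p ^ 3)) (Gen.a i j)) =
          ⁅(v i : HAlgebra p Γ), (v j : HAlgebra p Γ)⁆ := mk_lieA i j
      simp only [LieHom.comp_apply, hm, LieHom.map_lie, h]
  refine LieHom.ext fun x => ?_
  obtain ⟨x, rfl⟩ := LieSubmodule.Quotient.surjective_mk' _ x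
  exact LieHom.congr_fun hq x

theorem exists_hom {x : Γ.V → L} (hx : LieAdmissible p Γ x) :
    ∃ f : HAlgebra p Γ →ₗ⁅ZMod (p ^ 3)⁆ L, ∀ i, f (v i) = x i := by
  let F : FreeLie p Γ →ₗ⁅ZMod (p ^ 3)⁆ L :=
    FreeLieAlgebra.lift (ZMod (p ^ 3)) fun g => match g with
      | Gen.v i => x i
      | Gen.a i j => ⁅x i, x j⁆
  have hv : ∀ i, F (lieV p Γ i) = x i := fun i => FreeLieAlgebra.lift_of_apply _ _
  have ha : ∀ i j, F (lieA p Γ i j) = ⁅x i, x j⁆ := fun i j => FreeLieAlgebra.lift_of_apply _ _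
  have hF : lieIdeal p Γ ≤ F.ker := by
    refine LieSubmodule.lieSpan_le.2 ?_
    rintro _ (⟨i, j⟩ | ⟨i, j, k⟩ | ⟨i, j, k, l⟩ | ⟨i, j, h⟩ | ⟨i, j, h⟩) <;>
      rw [SetLike.mem_coe, LieHom.mem_ker]
    · rw [map_sub, LieHom.map_lie, hv, hv, ha, sub_self]
    · rw [LieHom.map_lie, hv, ha, hx.central]
    -- Commutation of the pair variables with each other follows from centrality over the vertices
    -- by the Jacobi identity, so `LieAdmissible` does not list it.
    · rw [LieHom.map_lie, ha, ha, leibniz_lie, hx.central, zero_lie, hx.central, lie_zero, add_zero]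
    · rw [map_smul, ha, hx.edge i j h]
    · rw [map_smul, ha, hx.nonedge i j h]
  let f : HAlgebra p Γ →ₗ⁅ZMod (p ^ 3)⁆ L :=
    { (lieIdeal p Γ).toSubmodule.liftQ (F : FreeLie p Γ →ₗ[ZMod (p ^ 3)] L)
        (fun y hy => (LieHom.mem_ker (f := F)).1 (hF hy)) with
      map_lie' := fun {y z} => by
        obtain ⟨y, rfl⟩ := LieSubmodule.Quotient.surjective_mk' _ y
        obtain ⟨z, rfl⟩ := LieSubmodule.Quotient.surjective_mk' _ z
        exact F.map_lie y z }
  exact ⟨f, hv⟩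

end HAlgebra

theorem LieAdmissible.map {L L' : Type*} [LieRing L] [LieAlgebra (ZMod (p ^ 3)) L]
    [LieRing L'] [LieAlgebra (ZMod (p ^ 3)) L'] {x : Γ.V → L} (hx : LieAdmissible p Γ x)
    (f : L →ₗ⁅ZMod (p ^ 3)⁆ L') : LieAdmissible p Γ (fun i => f (x i)) where
  central i j k := by rw [← LieHom.map_lie, ← LieHom.map_lie, hx.central, map_zero]
  edge i j h := by rw [← LieHom.map_lie, ← map_smul, hx.edge i j h, map_zero]
  nonedge i j h := by rw [← LieHom.map_lie, ← map_smul, hx.nonedge i j h, map_zero]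

theorem LieAdmissible.comp_iso {L : Type*} [LieRing L] [LieAlgebra (ZMod (p ^ 3)) L]
    {x : Δ.V → L} (hx : LieAdmissible p Δ x) (e : Γ.graph ≃g Δ.graph) :
    LieAdmissible p Γ (fun i => x (e i)) where
  central _ _ _ := hx.central _ _ _
  edge _ _ h := hx.edge _ _ (e.map_adj_iff.2 h)
  nonedge _ _ h := hx.nonedge _ _ fun h' => h (e.map_adj_iff.1 h')

theorem GraphIso.hAlgebraIso (h : GraphIso Γ Δ) : HAlgebraIso p Γ Δ := by
  obtain ⟨e⟩ := h
  obtain ⟨f, hf⟩ := HAlgebra.exists_hom ((HAlgebra.lieAdmissible_v (p := p)).comp_iso e)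
  obtain ⟨g, hg⟩ := HAlgebra.exists_hom ((HAlgebra.lieAdmissible_v (p := p)).comp_iso e.symm)
  have hgf : g.comp f = 1 := HAlgebra.hom_ext fun i => by simp [hf, hg]
  have hfg : f.comp g = 1 := HAlgebra.hom_ext fun i => by simp [hf, hg]
  exact ⟨{ f with
    invFun := g
    left_inv := fun x => LieHom.congr_fun hgf x
    right_inv := fun x => LieHom.congr_fun hfg x }⟩

/-- The Heisenberg Lie algebra with bracket `⁅x, y⁆ = p (x₁ y₂ - y₁ x₂)`. -/
def HeisenbergLie (p : ℕ) : Type := ZMod (p ^ 3) × ZMod (p ^ 3) × ZMod (p ^ 3)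

namespace HeisenbergLie

instance : AddCommGroup (HeisenbergLie p) :=
  inferInstanceAs (AddCommGroup (ZMod (p ^ 3) × ZMod (p ^ 3) × ZMod (p ^ 3)))

instance : Module (ZMod (p ^ 3)) (HeisenbergLie p) :=
  inferInstanceAs (Module (ZMod (p ^ 3)) (ZMod (p ^ 3) × ZMod (p ^ 3) × ZMod (p ^ 3)))

/-- The first coordinate. -/
def fst : HeisenbergLie p →ₗ[ZMod (p ^ 3)] ZMod (p ^ 3) := LinearMap.fst _ _ _

/-- The second coordinate. -/
def snd : HeisenbergLie p →ₗ[ZMod (p ^ 3)] ZMod (p ^ 3) :=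
  LinearMap.fst _ _ _ ∘ₗ LinearMap.snd (ZMod (p ^ 3)) (ZMod (p ^ 3)) (ZMod (p ^ 3) × ZMod (p ^ 3))

/-- The inclusion of the centre. -/
def inC : ZMod (p ^ 3) →ₗ[ZMod (p ^ 3)] HeisenbergLie p :=
  LinearMap.inr (ZMod (p ^ 3)) (ZMod (p ^ 3)) (ZMod (p ^ 3) × ZMod (p ^ 3)) ∘ₗ LinearMap.inr _ _ _

@[simp] theorem fst_inC (c : ZMod (p ^ 3)) : fst (inC c) = 0 := rfl

@[simp] theorem snd_inC (c : ZMod (p ^ 3)) : snd (inC c) = 0 := rfl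

theorem inC_injective : Function.Injective (inC (p := p)) := fun _ _ h =>
  congrArg (fun x : ZMod (p ^ 3) × ZMod (p ^ 3) × ZMod (p ^ 3) => x.2.2) h

instance : Bracket (HeisenbergLie p) (HeisenbergLie p) :=
  ⟨fun x y => inC ((p : ZMod (p ^ 3)) * (fst x * snd y - fst y * snd x))⟩

theorem lie_def (x y : HeisenbergLie p) :
    ⁅x, y⁆ = inC ((p : ZMod (p ^ 3)) * (fst x * snd y - fst y * snd x)) := rfl

instance : LieRing (HeisenbergLie p) where
  add_lie x y z := by
    rw [lie_def, lie_def, lie_def, ← map_add inC, map_add, map_add]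
    ring_nf
  lie_add x y z := by
    rw [lie_def, lie_def, lie_def, ← map_add inC, map_add, map_add]
    ring_nf
  lie_self x := by simp [lie_def]
  leibniz_lie x y z := by simp [lie_def]

instance : LieAlgebra (ZMod (p ^ 3)) (HeisenbergLie p) where
  lie_smul t x y := by
    rw [lie_def, lie_def, ← map_smul inC, map_smul, map_smul]
    simp only [smul_eq_mul]
    ring_nf

end HeisenbergLie

/-- The bracket carries one factor `p`. An edge adds a second, and `p ^ 2` times the determinant
vanishes exactly when the determinant is zero mod `p`; a non-edge adds two, giving `p ^ 3 = 0`. -/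
theorem lieAdmissible_heisenberg_iff (hp : p.Prime) (x : Γ.V → HeisenbergLie p) :
    LieAdmissible p Γ x ↔ Γ.graph.EdgeParallel
      (ZMod.castHom (Dvd.intro_left (p ^ 2) rfl : p ∣ p ^ 3) (ZMod p) ∘ fun i => (x i).fst)
      (ZMod.castHom (Dvd.intro_left (p ^ 2) rfl : p ∣ p ^ 3) (ZMod p) ∘ fun i => (x i).snd) := by
  have key : ∀ i j, (p : ZMod (p ^ 3)) • ⁅x i, x j⁆ = 0 ↔
      ZMod.castHom (Dvd.intro_left (p ^ 2) rfl : p ∣ p ^ 3) (ZMod p)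
        ((x i).fst * (x j).snd - (x j).fst * (x i).snd) = 0 := fun i j => by
    rw [← ZMod.sq_mul_eq_zero_iff hp, HeisenbergLie.lie_def, ← map_smul,
      map_eq_zero_iff _ HeisenbergLie.inC_injective, smul_eq_mul, ← mul_assoc, sq]
  have hp3 : (p : ZMod (p ^ 3)) ^ 2 * p = 0 := by
    rw [← pow_succ, ← Nat.cast_pow, ZMod.natCast_self]
  constructor
  · intro h i j hij
    have := (key i j).1 (h.edge i j hij)
    rw [map_sub, map_mul, map_mul, sub_eq_zero] at this
    exact this
  · intro h
    refine ⟨fun i j k => by simp [HeisenbergLie.lie_def], fun i j hij => (key i j).2 ?_,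
      fun i j _ => ?_⟩
    · rw [map_sub, map_mul, map_mul, sub_eq_zero]
      exact h i j hij
    · rw [HeisenbergLie.lie_def, ← map_smul, smul_eq_mul, ← mul_assoc, hp3, zero_mul, map_zero]

namespace HAlgebra

/-- A functional that kills brackets becomes a Lie homomorphism once its target is placed in the
centre of the Heisenberg algebra, so `hom_ext` applies. -/
theorem linearMap_ext {ℓ ℓ' : HAlgebra p Γ →ₗ[ZMod (p ^ 3)] ZMod (p ^ 3)}
    (hℓ : ∀ x y : HAlgebra p Γ, ℓ ⁅x, y⁆ = 0)
    (hℓ' : ∀ x y : HAlgebra p Γ, ℓ' ⁅x, y⁆ = 0) (h : ∀ i, ℓ (v i) = ℓ' (v i)) :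
    ℓ = ℓ' := by
  let f (m : HAlgebra p Γ →ₗ[ZMod (p ^ 3)] ZMod (p ^ 3)) (hm : ∀ x y : HAlgebra p Γ, m ⁅x, y⁆ = 0) :
      HAlgebra p Γ →ₗ⁅ZMod (p ^ 3)⁆ HeisenbergLie p :=
    { HeisenbergLie.inC ∘ₗ m with
      map_lie' := fun {x y} => by simp [HeisenbergLie.lie_def, hm] }
  have hf : f ℓ hℓ = f ℓ' hℓ' := hom_ext fun i => congrArg HeisenbergLie.inC (h i)
  exact LinearMap.ext fun x => HeisenbergLie.inC_injective (LieHom.congr_fun hf x)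

theorem exists_heisenberg (hp : p.Prime) (x y : Γ.V → ZMod (p ^ 3))
    (h : Γ.graph.EdgeParallel
      (ZMod.castHom (Dvd.intro_left (p ^ 2) rfl : p ∣ p ^ 3) (ZMod p) ∘ x)
      (ZMod.castHom (Dvd.intro_left (p ^ 2) rfl : p ∣ p ^ 3) (ZMod p) ∘ y)) :
    ∃ f : HAlgebra p Γ →ₗ⁅ZMod (p ^ 3)⁆ HeisenbergLie p,
      (∀ i, (f (v i)).fst = x i) ∧ ∀ i, (f (v i)).snd = y i := by
  let z : Γ.V → HeisenbergLie p := fun i => (x i, y i, 0)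
  obtain ⟨f, hf⟩ := exists_hom ((lieAdmissible_heisenberg_iff hp z).2 h)
  exact ⟨f, fun i => by rw [hf]; rfl, fun i => by rw [hf]; rfl⟩

/-- Taking the second vector to be zero satisfies every edge condition. This supplies the coordinate
functionals, showing that the abelianization is free on the vertices. -/
theorem exists_linearMap (hp : p.Prime) (x : Γ.V → ZMod (p ^ 3)) :
    ∃ ℓ : HAlgebra p Γ →ₗ[ZMod (p ^ 3)] ZMod (p ^ 3),
      (∀ y z : HAlgebra p Γ, ℓ ⁅y, z⁆ = 0) ∧ ∀ i, ℓ (v i) = x i := by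
  obtain ⟨f, hf, -⟩ := exists_heisenberg hp x 0 fun i j _ => by simp
  exact ⟨HeisenbergLie.fst ∘ₗ (f : HAlgebra p Γ →ₗ[ZMod (p ^ 3)] HeisenbergLie p),
    fun y z => by simp [HeisenbergLie.lie_def], hf⟩

end HAlgebra

/-- Composing `f` with the Heisenberg map attached to `x`, `y` gives a Heisenberg map of the source,
whose two vectors are `x` and `y` multiplied by the matrix of `f` on abelianizations. -/
theorem edgeParallel_pullback_lie (hp : p.Prime) [Fintype Δ.V] [DecidableEq Δ.V]
    (f : HAlgebra p Γ →ₗ⁅ZMod (p ^ 3)⁆ HAlgebra p Δ)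
    {c : Δ.V → HAlgebra p Δ →ₗ[ZMod (p ^ 3)] ZMod (p ^ 3)}
    (hc : ∀ w (y z : HAlgebra p Δ), c w ⁅y, z⁆ = 0)
    (hcv : ∀ w i, c w (HAlgebra.v i) = (1 : Matrix Δ.V Δ.V (ZMod (p ^ 3))) w i)
    (x y : Δ.V → ZMod (p ^ 3))
    (h : Δ.graph.EdgeParallel
      (ZMod.castHom (Dvd.intro_left (p ^ 2) rfl : p ∣ p ^ 3) (ZMod p) ∘ x)
      (ZMod.castHom (Dvd.intro_left (p ^ 2) rfl : p ∣ p ^ 3) (ZMod p) ∘ y)) :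
    Γ.graph.EdgeParallel
      (ZMod.castHom (Dvd.intro_left (p ^ 2) rfl : p ∣ p ^ 3) (ZMod p) ∘
        Matrix.vecMul x (Matrix.of fun w i => c w (f (HAlgebra.v i))))
      (ZMod.castHom (Dvd.intro_left (p ^ 2) rfl : p ∣ p ^ 3) (ZMod p) ∘
        Matrix.vecMul y (Matrix.of fun w i => c w (f (HAlgebra.v i)))) := by
  obtain ⟨g, hx, hy⟩ := HAlgebra.exists_heisenberg hp x y h
  have key : ∀ (π : HeisenbergLie p →ₗ[ZMod (p ^ 3)] ZMod (p ^ 3))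
      (_ : ∀ a b : HeisenbergLie p, π ⁅a, b⁆ = 0)
      (u : Δ.V → ZMod (p ^ 3)) (_ : ∀ i, π (g (HAlgebra.v i)) = u i) (a : HAlgebra p Δ),
      π (g a) = ∑ w, u w * c w a := by
    intro π hπ u hu a
    have := HAlgebra.linearMap_ext
      (ℓ := π ∘ₗ (g : HAlgebra p Δ →ₗ[ZMod (p ^ 3)] HeisenbergLie p)) (ℓ' := ∑ w, u w • c w)
      (fun a b => by simp [hπ]) (fun a b => by simp [hc])
      (fun i => by simp [hcv, hu, Matrix.one_apply])
    simpa using LinearMap.congr_fun this a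
  convert (lieAdmissible_heisenberg_iff hp _).1
    ((HAlgebra.lieAdmissible_v (p := p) (Γ := Γ)).map (g.comp f)) using 2
  · ext i
    exact (key HeisenbergLie.fst (fun a b => by simp [HeisenbergLie.lie_def]) x hx _).symm
  · ext i
    exact (key HeisenbergLie.snd (fun a b => by simp [HeisenbergLie.lie_def]) y hy _).symm

/-- Passing to the matrix on abelianizations is functorial; used in both directions, this makes the
matrix of an isomorphism invertible. -/
theorem coord_comp_mul_lie [Fintype Δ.V] [DecidableEq Γ.V] [DecidableEq Δ.V]
    (f : HAlgebra p Γ →ₗ⁅ZMod (p ^ 3)⁆ HAlgebra p Δ)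
    (g : HAlgebra p Δ →ₗ⁅ZMod (p ^ 3)⁆ HAlgebra p Γ) (hgf : ∀ a, g (f a) = a)
    {b : Γ.V → HAlgebra p Γ →ₗ[ZMod (p ^ 3)] ZMod (p ^ 3)}
    (hb : ∀ w (y z : HAlgebra p Γ), b w ⁅y, z⁆ = 0)
    (hbv : ∀ w i, b w (HAlgebra.v i) = (1 : Matrix Γ.V Γ.V (ZMod (p ^ 3))) w i)
    {c : Δ.V → HAlgebra p Δ →ₗ[ZMod (p ^ 3)] ZMod (p ^ 3)}
    (hc : ∀ w (y z : HAlgebra p Δ), c w ⁅y, z⁆ = 0)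
    (hcv : ∀ w i, c w (HAlgebra.v i) = (1 : Matrix Δ.V Δ.V (ZMod (p ^ 3))) w i) :
    (Matrix.of fun i w => b i (g (HAlgebra.v w))) *
      (Matrix.of fun w i => c w (f (HAlgebra.v i))) = 1 := by
  ext i j
  have := HAlgebra.linearMap_ext
    (ℓ := b i ∘ₗ (g : HAlgebra p Δ →ₗ[ZMod (p ^ 3)] HAlgebra p Γ))
    (ℓ' := ∑ w, b i (g (HAlgebra.v w)) • c w)
    (fun y z => by simp [hb]) (fun y z => by simp [hc])
    (fun w => by simp [hcv, Matrix.one_apply])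
  have h : b i (g (f (HAlgebra.v j))) =
      ∑ w, b i (g (HAlgebra.v w)) * c w (f (HAlgebra.v j)) := by
    simpa using LinearMap.congr_fun this (f (HAlgebra.v j))
  rw [hgf, hbv] at h
  exact h.symm

theorem HAlgebraIso.graphIso (hp : p.Prime) (hΔ : Δ.graph.NoAdjTwins)
    (h : HAlgebraIso p Γ Δ) : GraphIso Γ Δ := by
  classical
  have := Fact.mk hp
  have := Γ.finite
  have := Δ.finite
  have := Fintype.ofFinite Γ.V
  have := Fintype.ofFinite Δ.V
  obtain ⟨e⟩ := h
  choose b hb hbv using fun w : Γ.V => HAlgebra.exists_linearMap hp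
    ((1 : Matrix Γ.V Γ.V (ZMod (p ^ 3))) w)
  choose c hc hcv using fun w : Δ.V => HAlgebra.exists_linearMap hp
    ((1 : Matrix Δ.V Δ.V (ZMod (p ^ 3))) w)
  exact SimpleGraph.nonempty_iso_of_matrix Γ.graph Δ.graph hΔ
    (ZMod.castHom (Dvd.intro_left (p ^ 2) rfl : p ∣ p ^ 3) (ZMod p)) (ZMod.castHom_surjective _)
    _ _ (coord_comp_mul_lie e.symm.toLieHom e.toLieHom (fun a => e.apply_symm_apply a)
      hc hcv hb hbv)
    (coord_comp_mul_lie e.toLieHom e.symm.toLieHom (fun a => e.symm_apply_apply a)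
      hb hbv hc hcv)
    (edgeParallel_pullback_lie hp e.toLieHom hc hcv)
    (edgeParallel_pullback_lie hp e.symm.toLieHom hb hbv)

end Lie

end FinGraph

/-! ### H-groups and their maps into a Heisenberg group. -/

namespace FinGraph

section Group

open scoped commutatorElement
open Multiplicative

variable {p : ℕ} {Γ Δ : FinGraph.{u}}

/-- The family `x` satisfies the relations imposed on the vertices of the H-group of `Γ`. -/
structure GroupAdmissible (p : ℕ) (Γ : FinGraph.{u}) {G : Type*} [Group G] (x : Γ.V → G) :
    Prop where
  central : ∀ i j k, ⁅⁅x i, x j⁆, x k⁆ = 1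
  vertex : ∀ i, x i ^ p ^ 3 = 1
  edge : ∀ i j, Γ.graph.Adj i j → ⁅x i, x j⁆ ^ p = 1
  nonedge : ∀ i j, ¬ Γ.graph.Adj i j → ⁅x i, x j⁆ ^ p ^ 2 = 1

namespace HGroup

/-- The generator of the H-group at a vertex. -/
def v (i : Γ.V) : HGroup p Γ := PresentedGroup.mk _ (grpG Γ i)

theorem mk_grpA (i j : Γ.V) :
    PresentedGroup.mk {x | GroupRelator p Γ x} (grpA Γ i j) = ⁅(v i : HGroup p Γ), v j⁆ := by
  have h : PresentedGroup.mk {x | GroupRelator p Γ x} _ = 1 :=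
    PresentedGroup.one_of_mem (GroupRelator.commutator (p := p) i j)
  rw [map_mul, map_inv, mul_inv_eq_one, map_commutatorElement] at h
  exact h.symm

theorem groupAdmissible_v : GroupAdmissible p Γ (v (p := p)) where
  central i j k := by
    have h : PresentedGroup.mk {x | GroupRelator p Γ x} _ = 1 :=
      PresentedGroup.one_of_mem (GroupRelator.central_g (p := p) i j k)
    rwa [map_commutatorElement, mk_grpA] at h
  vertex i := by
    have h : PresentedGroup.mk {x | GroupRelator p Γ x} _ = 1 :=
      PresentedGroup.one_of_mem (GroupRelator.vertex (p := p) i)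
    rwa [map_pow] at h
  edge i j hij := by
    have h : PresentedGroup.mk {x | GroupRelator p Γ x} _ = 1 :=
      PresentedGroup.one_of_mem (GroupRelator.edge (p := p) i j hij)
    rwa [map_pow, mk_grpA] at h
  nonedge i j hij := by
    have h : PresentedGroup.mk {x | GroupRelator p Γ x} _ = 1 :=
      PresentedGroup.one_of_mem (GroupRelator.nonedge (p := p) i j hij)
    rwa [map_pow, mk_grpA] at h

variable {G : Type*} [Group G]

theorem hom_ext {f g : HGroup p Γ →* G} (h : ∀ i, f (v i) = g (v i)) : f = g := by
  refine PresentedGroup.ext fun x => ?_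
  cases x with
  | v i => exact h i
  | a i j =>
    have hm : (PresentedGroup.of (Gen.a i j) : HGroup p Γ) = ⁅v i, v j⁆ := mk_grpA i j
    rw [hm, map_commutatorElement, map_commutatorElement, h, h]

theorem exists_hom {x : Γ.V → G} (hx : GroupAdmissible p Γ x) :
    ∃ f : HGroup p Γ →* G, ∀ i, f (v i) = x i := by
  let F : Gen Γ.V → G := fun g => match g with
    | Gen.v i => x i
    | Gen.a i j => ⁅x i, x j⁆
  have hv : ∀ i, FreeGroup.lift F (grpG Γ i) = x i := fun i => FreeGroup.lift_apply_of
  have ha : ∀ i j, FreeGroup.lift F (grpA Γ i j) = ⁅x i, x j⁆ := fun i j => FreeGroup.lift_apply_of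
  have hF : ∀ r ∈ {x | GroupRelator p Γ x}, FreeGroup.lift F r = 1 := by
    rintro _ (⟨i, j⟩ | ⟨i, j, k⟩ | ⟨i, j, k, l⟩ | ⟨i⟩ | ⟨i, j, h⟩ | ⟨i, j, h⟩)
    · rw [map_mul, map_inv, map_commutatorElement, hv, hv, ha, mul_inv_cancel]
    · rw [map_commutatorElement, hv, ha, hx.central]
    · rw [map_commutatorElement, ha, ha, commutatorElement_eq_one_iff_commute]
      have hc : ∀ k, Commute ⁅x i, x j⁆ (x k) := fun k =>
        commutatorElement_eq_one_iff_commute.1 (hx.central i j k)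
      rw [commutatorElement_def (x k)]
      exact (((hc k).mul_right (hc l)).mul_right (hc k).inv_right).mul_right (hc l).inv_right
    · rw [map_pow, hv, hx.vertex]
    · rw [map_pow, ha, hx.edge i j h]
    · rw [map_pow, ha, hx.nonedge i j h]
  exact ⟨PresentedGroup.toGroup hF, fun i => PresentedGroup.toGroup.of hF⟩

end HGroup

theorem GroupAdmissible.map {G G' : Type*} [Group G] [Group G'] {x : Γ.V → G}
    (hx : GroupAdmissible p Γ x) (f : G →* G') : GroupAdmissible p Γ (fun i => f (x i)) where
  central i j k := by
    rw [← map_commutatorElement, ← map_commutatorElement, hx.central, map_one]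
  vertex i := by rw [← map_pow, hx.vertex, map_one]
  edge i j h := by rw [← map_commutatorElement, ← map_pow, hx.edge i j h, map_one]
  nonedge i j h := by rw [← map_commutatorElement, ← map_pow, hx.nonedge i j h, map_one]

theorem GroupAdmissible.comp_iso {G : Type*} [Group G] {x : Δ.V → G}
    (hx : GroupAdmissible p Δ x) (e : Γ.graph ≃g Δ.graph) :
    GroupAdmissible p Γ (fun i => x (e i)) where
  central _ _ _ := hx.central _ _ _
  vertex _ := hx.vertex _
  edge _ _ h := hx.edge _ _ (e.map_adj_iff.2 h)
  nonedge _ _ h := hx.nonedge _ _ fun h' => h (e.map_adj_iff.1 h')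

theorem GraphIso.hGroupIso (h : GraphIso Γ Δ) : HGroupIso p Γ Δ := by
  obtain ⟨e⟩ := h
  obtain ⟨f, hf⟩ := HGroup.exists_hom ((HGroup.groupAdmissible_v (p := p)).comp_iso e)
  obtain ⟨g, hg⟩ := HGroup.exists_hom ((HGroup.groupAdmissible_v (p := p)).comp_iso e.symm)
  exact ⟨f.toMulEquiv g (HGroup.hom_ext fun i => by simp [hf, hg])
    (HGroup.hom_ext fun i => by simp [hf, hg])⟩

/-- The Heisenberg group over `ℤ/p³` with commutator `⁅x, y⁆ = p (x₁ y₂ - y₁ x₂)`. -/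
@[ext]
structure HeisenbergGroup (p : ℕ) : Type where
  fst : ZMod (p ^ 3)
  snd : ZMod (p ^ 3)
  thd : ZMod (p ^ 3)

namespace HeisenbergGroup

instance : Mul (HeisenbergGroup p) :=
  ⟨fun x y => ⟨x.fst + y.fst, x.snd + y.snd, x.thd + y.thd + p * x.fst * y.snd⟩⟩

instance : One (HeisenbergGroup p) := ⟨⟨0, 0, 0⟩⟩

instance : Inv (HeisenbergGroup p) :=
  ⟨fun x => ⟨-x.fst, -x.snd, -x.thd + p * x.fst * x.snd⟩⟩

@[simp] theorem fst_mul (x y : HeisenbergGroup p) : (x * y).fst = x.fst + y.fst := rfl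
@[simp] theorem snd_mul (x y : HeisenbergGroup p) : (x * y).snd = x.snd + y.snd := rfl
@[simp] theorem thd_mul (x y : HeisenbergGroup p) :
    (x * y).thd = x.thd + y.thd + p * x.fst * y.snd := rfl
@[simp] theorem fst_one : (1 : HeisenbergGroup p).fst = 0 := rfl
@[simp] theorem snd_one : (1 : HeisenbergGroup p).snd = 0 := rfl
@[simp] theorem thd_one : (1 : HeisenbergGroup p).thd = 0 := rfl
@[simp] theorem fst_inv (x : HeisenbergGroup p) : x⁻¹.fst = -x.fst := rfl
@[simp] theorem snd_inv (x : HeisenbergGroup p) : x⁻¹.snd = -x.snd := rfl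
@[simp] theorem thd_inv (x : HeisenbergGroup p) :
    x⁻¹.thd = -x.thd + p * x.fst * x.snd := rfl

instance : Group (HeisenbergGroup p) :=
  Group.ofLeftAxioms (fun x y z => by ext <;> simp <;> ring) (fun x => by ext <;> simp)
    (fun x => by ext <;> simp)

theorem commutator_eq (x y : HeisenbergGroup p) :
    ⁅x, y⁆ = ⟨0, 0, p * (x.fst * y.snd - y.fst * x.snd)⟩ := by
  rw [commutatorElement_def]
  ext <;> simp
  ring

theorem pow_eq (x : HeisenbergGroup p) (n : ℕ) :
    x ^ n = ⟨n * x.fst, n * x.snd, n * x.thd + p * n.choose 2 * x.fst * x.snd⟩ := by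
  induction n with
  | zero => ext <;> simp
  | succ n ih =>
    rw [pow_succ, ih]
    ext
    · simp; ring
    · simp; ring
    · simp only [thd_mul, Nat.choose_succ_succ' n 1, Nat.choose_one_right]
      push_cast
      ring

/-- The first coordinate. -/
def fstHom : HeisenbergGroup p →* Multiplicative (ZMod (p ^ 3)) where
  toFun x := ofAdd x.fst
  map_one' := rfl
  map_mul' _ _ := rfl

/-- The second coordinate. -/
def sndHom : HeisenbergGroup p →* Multiplicative (ZMod (p ^ 3)) where
  toFun x := ofAdd x.snd
  map_one' := rfl
  map_mul' _ _ := rfl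

/-- The mixed term of the power carries `(p ^ 3).choose 2`, which is divisible by `p ^ 3` because
`p` is odd. -/
theorem pow_cube_eq_one (hp : p.Prime) (hp2 : p ≠ 2) (x : HeisenbergGroup p) :
    x ^ p ^ 3 = 1 := by
  have hdvd : p ^ 3 ∣ (p ^ 3).choose 2 := by
    have hcop : Nat.Coprime (p ^ 3) 2 :=
      Nat.Coprime.pow_left 3 ((Nat.coprime_primes hp Nat.prime_two).2 hp2)
    refine hcop.dvd_of_dvd_mul_right ?_
    rw [Nat.choose_two_right, Nat.div_mul_cancel (Nat.even_mul_pred_self _).two_dvd]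
    exact dvd_mul_right _ _
  rw [pow_eq, ZMod.natCast_self, (ZMod.natCast_eq_zero_iff _ _).2 hdvd]
  ext <;> simp

end HeisenbergGroup

/-- As for the Lie algebra, with powers of commutators in place of multiples of brackets; the vertex
relation imposes nothing, by `pow_cube_eq_one`. -/
theorem groupAdmissible_heisenberg_iff (hp : p.Prime) (hp2 : p ≠ 2)
    (x : Γ.V → HeisenbergGroup p) :
    GroupAdmissible p Γ x ↔ Γ.graph.EdgeParallel
      (ZMod.castHom (Dvd.intro_left (p ^ 2) rfl : p ∣ p ^ 3) (ZMod p) ∘ fun i => (x i).fst)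
      (ZMod.castHom (Dvd.intro_left (p ^ 2) rfl : p ∣ p ^ 3) (ZMod p) ∘ fun i => (x i).snd) := by
  have key : ∀ i j, ⁅x i, x j⁆ ^ p = 1 ↔
      ZMod.castHom (Dvd.intro_left (p ^ 2) rfl : p ∣ p ^ 3) (ZMod p)
        ((x i).fst * (x j).snd - (x j).fst * (x i).snd) = 0 := fun i j => by
    rw [← ZMod.sq_mul_eq_zero_iff hp, HeisenbergGroup.commutator_eq, HeisenbergGroup.pow_eq,
      HeisenbergGroup.ext_iff]
    simp [← mul_assoc, sq]
  have hp3 : (p : ZMod (p ^ 3)) ^ 2 * p = 0 := by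
    rw [← pow_succ, ← Nat.cast_pow, ZMod.natCast_self]
  constructor
  · intro h i j hij
    have := (key i j).1 (h.edge i j hij)
    rw [map_sub, map_mul, map_mul, sub_eq_zero] at this
    exact this
  · intro h
    refine ⟨fun i j k => ?_, fun i => HeisenbergGroup.pow_cube_eq_one hp hp2 _,
      fun i j hij => (key i j).2 ?_, fun i j _ => ?_⟩
    · rw [HeisenbergGroup.commutator_eq ⁅x i, x j⁆, HeisenbergGroup.commutator_eq (x i)]
      ext <;> simp
    · rw [map_sub, map_mul, map_mul, sub_eq_zero]
      exact h i j hij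
    · rw [HeisenbergGroup.commutator_eq, HeisenbergGroup.pow_eq]
      ext <;> simp [← mul_assoc, hp3]

namespace HGroup

theorem exists_heisenberg (hp : p.Prime) (hp2 : p ≠ 2) (x y : Γ.V → ZMod (p ^ 3))
    (h : Γ.graph.EdgeParallel
      (ZMod.castHom (Dvd.intro_left (p ^ 2) rfl : p ∣ p ^ 3) (ZMod p) ∘ x)
      (ZMod.castHom (Dvd.intro_left (p ^ 2) rfl : p ∣ p ^ 3) (ZMod p) ∘ y)) :
    ∃ f : HGroup p Γ →* HeisenbergGroup p,
      (∀ i, (f (v i)).fst = x i) ∧ ∀ i, (f (v i)).snd = y i := by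
  obtain ⟨f, hf⟩ := exists_hom ((groupAdmissible_heisenberg_iff hp hp2
    (fun i => ⟨x i, y i, 0⟩)).2 h)
  exact ⟨f, fun i => by rw [hf], fun i => by rw [hf]⟩

/-- Characters play the role of the functionals that kill brackets; vanishing on commutators is
automatic because the target is abelian. -/
theorem exists_character (hp : p.Prime) (hp2 : p ≠ 2) (x : Γ.V → ZMod (p ^ 3)) :
    ∃ ℓ : HGroup p Γ →* Multiplicative (ZMod (p ^ 3)), ∀ i, (ℓ (v i)).toAdd = x i := by
  obtain ⟨f, hf, -⟩ := exists_heisenberg hp hp2 x 0 fun i j _ => by simp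
  exact ⟨HeisenbergGroup.fstHom.comp f, hf⟩

/-- A character of the H-group is a linear combination of coordinate characters. -/
theorem character_eq_sum [Fintype Γ.V] [DecidableEq Γ.V]
    {c : Γ.V → HGroup p Γ →* Multiplicative (ZMod (p ^ 3))}
    (hc : ∀ w i, (c w (v i)).toAdd = (1 : Matrix Γ.V Γ.V (ZMod (p ^ 3))) w i)
    (ℓ : HGroup p Γ →* Multiplicative (ZMod (p ^ 3))) {x : Γ.V → ZMod (p ^ 3)}
    (hx : ∀ i, (ℓ (v i)).toAdd = x i) (a : HGroup p Γ) :
    (ℓ a).toAdd = ∑ w, x w * (c w a).toAdd := by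
  let ℓ' : HGroup p Γ →* Multiplicative (ZMod (p ^ 3)) :=
    { toFun := fun a => ofAdd (∑ w, x w * (c w a).toAdd)
      map_one' := by simp
      map_mul' := fun a b => by simp [mul_add, Finset.sum_add_distrib] }
  have h : ℓ = ℓ' := hom_ext fun i => by
    apply toAdd.injective
    simp [ℓ', hx, hc, Matrix.one_apply]
  exact congrArg toAdd (DFunLike.congr_fun h a)

end HGroup

theorem edgeParallel_pullback_group (hp : p.Prime) (hp2 : p ≠ 2) [Fintype Δ.V]
    [DecidableEq Δ.V] (f : HGroup p Γ →* HGroup p Δ)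
    {c : Δ.V → HGroup p Δ →* Multiplicative (ZMod (p ^ 3))}
    (hc : ∀ w i, (c w (HGroup.v i)).toAdd = (1 : Matrix Δ.V Δ.V (ZMod (p ^ 3))) w i)
    (x y : Δ.V → ZMod (p ^ 3))
    (h : Δ.graph.EdgeParallel
      (ZMod.castHom (Dvd.intro_left (p ^ 2) rfl : p ∣ p ^ 3) (ZMod p) ∘ x)
      (ZMod.castHom (Dvd.intro_left (p ^ 2) rfl : p ∣ p ^ 3) (ZMod p) ∘ y)) :
    Γ.graph.EdgeParallel
      (ZMod.castHom (Dvd.intro_left (p ^ 2) rfl : p ∣ p ^ 3) (ZMod p) ∘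
        Matrix.vecMul x (Matrix.of fun w i => (c w (f (HGroup.v i))).toAdd))
      (ZMod.castHom (Dvd.intro_left (p ^ 2) rfl : p ∣ p ^ 3) (ZMod p) ∘
        Matrix.vecMul y (Matrix.of fun w i => (c w (f (HGroup.v i))).toAdd)) := by
  obtain ⟨g, hx, hy⟩ := HGroup.exists_heisenberg hp hp2 x y h
  convert (groupAdmissible_heisenberg_iff hp hp2 _).1
    ((HGroup.groupAdmissible_v (p := p) (Γ := Γ)).map (g.comp f)) using 2
  · ext i
    exact (HGroup.character_eq_sum hc (HeisenbergGroup.fstHom.comp g) hx _).symm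
  · ext i
    exact (HGroup.character_eq_sum hc (HeisenbergGroup.sndHom.comp g) hy _).symm

theorem coord_comp_mul_group [Fintype Δ.V] [DecidableEq Γ.V] [DecidableEq Δ.V]
    (f : HGroup p Γ →* HGroup p Δ) (g : HGroup p Δ →* HGroup p Γ) (hgf : ∀ a, g (f a) = a)
    {b : Γ.V → HGroup p Γ →* Multiplicative (ZMod (p ^ 3))}
    (hb : ∀ w i, (b w (HGroup.v i)).toAdd = (1 : Matrix Γ.V Γ.V (ZMod (p ^ 3))) w i)
    {c : Δ.V → HGroup p Δ →* Multiplicative (ZMod (p ^ 3))}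
    (hc : ∀ w i, (c w (HGroup.v i)).toAdd = (1 : Matrix Δ.V Δ.V (ZMod (p ^ 3))) w i) :
    (Matrix.of fun i w => (b i (g (HGroup.v w))).toAdd) *
      (Matrix.of fun w i => (c w (f (HGroup.v i))).toAdd) = 1 := by
  ext i j
  have h := HGroup.character_eq_sum hc ((b i).comp g) (fun _ => rfl) (f (HGroup.v j))
  rw [MonoidHom.comp_apply, hgf, hb] at h
  exact h.symm

theorem HGroupIso.graphIso (hp : p.Prime) (hp2 : p ≠ 2) (hΔ : Δ.graph.NoAdjTwins)
    (h : HGroupIso p Γ Δ) : GraphIso Γ Δ := by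
  classical
  have := Fact.mk hp
  have := Γ.finite
  have := Δ.finite
  have := Fintype.ofFinite Γ.V
  have := Fintype.ofFinite Δ.V
  obtain ⟨e⟩ := h
  choose b hb using fun w : Γ.V => HGroup.exists_character hp hp2
    ((1 : Matrix Γ.V Γ.V (ZMod (p ^ 3))) w)
  choose c hc using fun w : Δ.V => HGroup.exists_character hp hp2
    ((1 : Matrix Δ.V Δ.V (ZMod (p ^ 3))) w)
  exact SimpleGraph.nonempty_iso_of_matrix Γ.graph Δ.graph hΔ
    (ZMod.castHom (Dvd.intro_left (p ^ 2) rfl : p ∣ p ^ 3) (ZMod p)) (ZMod.castHom_surjective _)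
    _ _ (coord_comp_mul_group e.symm.toMonoidHom e.toMonoidHom (fun a => e.apply_symm_apply a)
      hc hb)
    (coord_comp_mul_group e.toMonoidHom e.symm.toMonoidHom (fun a => e.symm_apply_apply a) hb hc)
    (edgeParallel_pullback_group hp hp2 e.toMonoidHom hc)
    (edgeParallel_pullback_group hp hp2 e.symm.toMonoidHom hb)

end Group

end FinGraph

/-! ### Layered graphs encoding families of binary relations. -/

namespace SimpleGraph

/-- The vertex has the same neighbours as another vertex. -/
def HasTwin {V : Type*} (G : SimpleGraph V) (v : V) : Prop :=
  ∃ u, u ≠ v ∧ ∀ m, G.Adj v m ↔ G.Adj u m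

theorem HasTwin.map_iso {V W : Type*} {G : SimpleGraph V} {H : SimpleGraph W} (θ : G ≃g H)
    {v : V} (h : G.HasTwin v) : H.HasTwin (θ v) := by
  obtain ⟨u, hu, h⟩ := h
  refine ⟨θ u, θ.injective.ne hu, fun m => ?_⟩
  obtain ⟨m, rfl⟩ := θ.surjective m
  rw [θ.map_adj_iff, θ.map_adj_iff, h]

theorem hasTwin_iso_iff {V W : Type*} {G : SimpleGraph V} {H : SimpleGraph W} (θ : G ≃g H)
    (v : V) : H.HasTwin (θ v) ↔ G.HasTwin v :=
  ⟨fun h => by simpa using h.map_iso θ.symm, fun h => h.map_iso θ⟩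

section Layered

variable {r : ℕ} {W : Type*}

/-- The colours of the layered graph: base layers and marker layers. -/
abbrev LayerColor (r : ℕ) : Type := Fin (r + 2) ⊕ Fin (r + 2)

/-- The adjacency rule of the layered graph, as a function of the colours of two vertices `x`, `y`,
of the truth value of `x = y`, and of the set of relations that hold for `(x, y)`. Each base layer
is matched with the base layer `0`, the relation `i` is drawn between the base layers `i + 2`
and `1`, and the marker layer `j` is joined to all base layers above `j`. -/
def layerRule (eq : Prop) (J : Fin r → Prop) : LayerColor r → LayerColor r → Prop
  | .inl s, .inl s' => (s = 0 ∧ s' ≠ 0 ∧ eq) ∨ ∃ i, s = Fin.succ (Fin.succ i) ∧ s' = 1 ∧ J i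
  | .inr j, .inl s => j < s
  | _, .inr _ => False

theorem layerRule_congr {eq eq' : Prop} {J J' : Fin r → Prop} (h : eq ↔ eq')
    (hJ : ∀ i, J i ↔ J' i) (s s' : LayerColor r) :
    layerRule eq J s s' ↔ layerRule eq' J' s s' := by
  rw [propext h, funext fun i => propext (hJ i)]

/-- A graph that encodes the family of binary relations `R` on `W`. -/
def layered (R : Fin r → W → W → Prop) : SimpleGraph (LayerColor r × W) :=
  SimpleGraph.fromRel fun v w => layerRule (v.2 = w.2) (fun i => R i v.2 w.2) v.1 w.1

variable (R : Fin r → W → W → Prop)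

theorem layered_adj_marker_base (j s : Fin (r + 2)) (x y : W) :
    (layered R).Adj (.inr j, x) (.inl s, y) ↔ j < s := by
  simp [layered, layerRule]

theorem layered_adj_base_marker (j s : Fin (r + 2)) (x y : W) :
    (layered R).Adj (.inl s, y) (.inr j, x) ↔ j < s := by
  rw [adj_comm, layered_adj_marker_base]

theorem not_layered_adj_marker (j s : Fin (r + 2)) (x y : W) :
    ¬ (layered R).Adj (.inr j, x) (.inr s, y) := by
  simp [layered, layerRule]

theorem layered_adj_core (s : Fin (r + 2)) (x y : W) :
    (layered R).Adj (.inl 0, x) (.inl s, y) ↔ s ≠ 0 ∧ x = y := by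
  have h : ∀ i : Fin r, (0 : Fin (r + 2)) ≠ i.succ.succ := fun i => (Fin.succ_ne_zero _).symm
  simp only [layered, layerRule, fromRel_adj, h, false_and, exists_false, or_false, true_and,
    ne_eq, not_true, and_false, Prod.mk.injEq, Sum.inl.injEq]
  have h1 : (0 : Fin (r + 2)) ≠ 1 := by simp
  simp only [h1, false_and, and_false, exists_false, or_false]
  exact ⟨fun h => h.2, fun h => ⟨fun h' => h.1 h'.1.symm, h⟩⟩

theorem layered_adj_relation (i : Fin r) (x y : W) :
    (layered R).Adj (.inl i.succ.succ, x) (.inl 1, y) ↔ R i x y := by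
  have h2 : ∀ i : Fin r, i.succ.succ ≠ (1 : Fin (r + 2)) := fun i h =>
    Fin.succ_ne_zero i (Fin.succ_injective (r + 1) h)
  simp only [layered, layerRule, fromRel_adj]
  constructor
  · rintro ⟨-, (⟨h, -⟩ | ⟨k, h, -, hk⟩) | (⟨h, -⟩ | ⟨k, h, -⟩)⟩
    · exact absurd h (Fin.succ_ne_zero _)
    · rwa [Fin.succ_injective _ (Fin.succ_injective _ h)]
    · exact absurd h (by simp)
    · exact absurd h.symm (h2 k)
  · exact fun h => ⟨fun h' => h2 i (Sum.inl_injective (congrArg Prod.fst h')),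
      Or.inl (Or.inr ⟨i, rfl, trivial, h⟩)⟩

theorem not_layered_adj_same (s : Fin (r + 2)) (x y : W) :
    ¬ (layered R).Adj (.inl s, x) (.inl s, y) := by
  have h2 : ∀ i : Fin r, i.succ.succ ≠ (1 : Fin (r + 2)) := fun i h =>
    Fin.succ_ne_zero i (Fin.succ_injective (r + 1) h)
  simp only [layered, layerRule, fromRel_adj]
  rintro ⟨-, (⟨h, h', -⟩ | ⟨i, h, h', -⟩) | (⟨h, h', -⟩ | ⟨i, h, h', -⟩)⟩
  · exact h' h
  · exact h2 i (h.symm.trans h')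
  · exact h' h
  · exact h2 i (h.symm.trans h')

/-- Adjacent base vertices lie in different layers, and a marker with the lower index sees only the
higher one. A base vertex adjacent to a marker lies above layer 0, so it has a partner in layer 0,
which no marker sees. -/
theorem layered_noAdjTwins : (layered R).NoAdjTwins := by
  have hb : ∀ (s s' : Fin (r + 2)) (x y : W), s < s' →
      (layered R).Adj (.inl s', y) (.inr s, x) ∧ ¬ (layered R).Adj (.inl s, x) (.inr s, x) :=
    fun s s' x y h => by simp [layered_adj_base_marker, h]
  have hm : ∀ (s j : Fin (r + 2)) (x y : W), j < s →
      (layered R).Adj (.inl s, x) (.inl 0, x) ∧ ¬ (layered R).Adj (.inr j, y) (.inl 0, x) := by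
    intro s j x y h
    rw [adj_comm, layered_adj_core, layered_adj_marker_base]
    exact ⟨⟨((Fin.zero_le j).trans_lt h).ne', rfl⟩, (Fin.zero_le j).not_gt⟩
  rintro ⟨s | s, x⟩ ⟨s' | s', y⟩ h
  · rcases lt_trichotomy s s' with hs | rfl | hs
    · exact ⟨(.inr s, x), by simp, by simp, fun h' => (hb s s' x y hs).2 (h'.2 (hb s s' x y hs).1)⟩
    · exact absurd h (not_layered_adj_same R s x y)
    · exact ⟨(.inr s', y), by simp, by simp,
        fun h' => (hb s' s y x hs).2 (h'.1 (hb s' s y x hs).1)⟩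
  · rw [layered_adj_base_marker] at h
    have h0 := hm s s' x y h
    exact ⟨(.inl 0, x), h0.1.ne', by simp, fun h' => h0.2 (h'.1 h0.1)⟩
  · rw [layered_adj_marker_base] at h
    have h0 := hm s' s y x h
    exact ⟨(.inl 0, y), by simp, h0.1.ne', fun h' => h0.2 (h'.2 h0.1)⟩
  · exact absurd h (not_layered_adj_marker R s s' x y)

/-- Markers separate the layers, and the matching with layer 0 separates vertices within a layer.
Nontriviality matters: over a one-point `W`, marker layer 0 and base layer 0 have the same
neighbours. -/
theorem not_layered_hasTwin_base [Nontrivial W] (s : Fin (r + 2)) (x : W) :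
    ¬ (layered R).HasTwin (.inl s, x) := by
  rintro ⟨⟨s' | j, y⟩, hne, h⟩
  · have hss : s = s' := by
      rcases lt_trichotomy s s' with hs | hs | hs
      · have := h (.inr s, x)
        simp [layered_adj_base_marker, hs] at this
      · exact hs
      · have := h (.inr s', x)
        simp [layered_adj_base_marker, hs] at this
    subst hss
    rcases eq_or_ne s 0 with rfl | hs
    · have := h (.inl 1, x)
      simp only [layered_adj_core, and_true] at this
      exact hne (by rw [(this.1 (by simp)).2])
    · have := h (.inl 0, x)
      rw [adj_comm, layered_adj_core, adj_comm, layered_adj_core] at this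
      exact hne (by rw [(this.1 ⟨hs, rfl⟩).2])
  · rcases eq_or_ne s 0 with rfl | hs
    · obtain ⟨x', hx'⟩ := exists_ne x
      have h1 := h (.inl 1, x)
      have h2 := h (.inl 1, x')
      rw [layered_adj_core, layered_adj_marker_base] at h1 h2
      exact hx' (h2.2 (h1.1 ⟨by simp, rfl⟩)).2.symm
    · have := h (.inl 0, x)
      rw [adj_comm, layered_adj_core, layered_adj_marker_base] at this
      exact (Fin.zero_le j).not_gt (this.1 ⟨hs, rfl⟩)

theorem layered_hasTwin_marker [Nontrivial W] (j : Fin (r + 2)) (x : W) :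
    (layered R).HasTwin (.inr j, x) := by
  obtain ⟨y, hy⟩ := exists_ne x
  refine ⟨(.inr j, y), by simpa using hy, ?_⟩
  rintro ⟨s | s, z⟩
  · simp [layered_adj_marker_base]
  · simp [not_layered_adj_marker]

/-- Having a twin characterizes markers, so this count is invariant under isomorphism and reveals
the layer of a base vertex. -/
theorem ncard_layered_markers [Nontrivial W] (s : Fin (r + 2)) (x : W) :
    {u | (layered R).HasTwin u ∧ (layered R).Adj (.inl s, x) u}.ncard = s * Nat.card W := by
  have hset : {u | (layered R).HasTwin u ∧ (layered R).Adj (.inl s, x) u} =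
      (fun q : Fin (r + 2) × W => ((.inr q.1, q.2) : LayerColor r × W)) ''
        (Set.Iio s ×ˢ Set.univ) := by
    ext ⟨j | j, y⟩
    · simp [not_layered_hasTwin_base]
    · simp [layered_hasTwin_marker, layered_adj_base_marker]
  rw [hset, Set.ncard_image_of_injective _ (fun a b h => by simpa [Prod.ext_iff] using h),
    Set.ncard_prod, Set.ncard_univ, ← Finset.coe_Iio, Set.ncard_coe_finset, Fin.card_Iio]

variable {R} {W' : Type*} {R' : Fin r → W' → W' → Prop}

theorem card_eq_of_layered_iso [Finite W] [Finite W'] (θ : layered R ≃g layered R') :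
    Nat.card W = Nat.card W' := by
  have h := Nat.card_congr θ.toEquiv
  rw [Nat.card_prod, Nat.card_prod] at h
  exact Nat.eq_of_mul_eq_mul_left Nat.card_pos h

theorem layered_iso_base [Finite W] [Finite W'] [Nontrivial W] [Nontrivial W']
    (θ : layered R ≃g layered R') (s : Fin (r + 2)) (x : W) :
    θ (.inl s, x) = (.inl s, (θ (.inl s, x)).2) := by
  rcases hθ : θ (.inl s, x) with ⟨s' | j, y⟩
  · have h := ncard_layered_markers R s x
    have himg : θ '' {u | (layered R).HasTwin u ∧ (layered R).Adj (.inl s, x) u} =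
        {u | (layered R').HasTwin u ∧ (layered R').Adj (.inl s', y) u} := by
      ext u
      obtain ⟨u, rfl⟩ := θ.surjective u
      rw [θ.injective.mem_set_image, Set.mem_ofPred_eq, Set.mem_ofPred_eq, hasTwin_iso_iff, ← hθ,
        θ.map_adj_iff]
    rw [← Set.ncard_image_of_injective _ θ.injective, himg, ncard_layered_markers,
      card_eq_of_layered_iso θ] at h
    rw [Fin.ext (Nat.eq_of_mul_eq_mul_right Nat.card_pos h)]
  · have := layered_hasTwin_marker R' j y
    rw [← hθ, hasTwin_iso_iff] at this
    exact absurd this (not_layered_hasTwin_base R s x)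

/-- Layers are preserved, so restriction to layer 0 gives a bijection `f`. The matching forces the
same `f` on every base layer, and the edges between layers `i + 2` and 1 then transport the
relations. -/
theorem exists_equiv_of_layered_iso [Finite W] [Finite W'] [Nontrivial W] [Nontrivial W']
    (θ : layered R ≃g layered R') : ∃ f : W ≃ W', ∀ i x y, R i x y ↔ R' i (f x) (f y) := by
  let f : W ≃ W' :=
    { toFun := fun x => (θ (.inl 0, x)).2
      invFun := fun y => (θ.symm (.inl 0, y)).2
      left_inv := fun x => by
        beta_reduce
        rw [← layered_iso_base θ 0 x, θ.symm_apply_apply]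
      right_inv := fun y => by
        beta_reduce
        rw [← layered_iso_base θ.symm 0 y, θ.apply_symm_apply] }
  have h0 : ∀ x, θ (.inl 0, x) = (.inl 0, f x) := fun x => layered_iso_base θ 0 x
  have hf : ∀ s x, s ≠ 0 → θ (.inl s, x) = (.inl s, f x) := by
    intro s x hs
    have h : (layered R).Adj (.inl 0, x) (.inl s, x) := (layered_adj_core R s x x).2 ⟨hs, rfl⟩
    rw [← θ.map_adj_iff, h0, layered_iso_base θ s x, layered_adj_core] at h
    rw [layered_iso_base θ s x, ← h.2]
  refine ⟨f, fun i x y => ?_⟩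
  rw [← layered_adj_relation R, ← layered_adj_relation R', ← θ.map_adj_iff,
    hf _ _ (Fin.succ_ne_zero _), hf 1 _ (by simp)]

theorem layered_iso_of_equiv (f : W ≃ W') (hf : ∀ i x y, R i x y ↔ R' i (f x) (f y)) :
    Nonempty (layered R ≃g layered R') := by
  refine ⟨⟨(Equiv.refl _).prodCongr f, @fun a b => ?_⟩⟩
  have h : ∀ a b : LayerColor r × W,
      layerRule (f a.2 = f b.2) (fun i => R' i (f a.2) (f b.2)) a.1 b.1 ↔
        layerRule (a.2 = b.2) (fun i => R i a.2 b.2) a.1 b.1 := fun a b =>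
    layerRule_congr f.injective.eq_iff (fun i => (hf i _ _).symm) _ _
  simp only [layered, fromRel_adj, ne_eq, (Equiv.injective _).eq_iff]
  exact and_congr Iff.rfl (or_congr (h a b) (h b a))

end Layered

end SimpleGraph

/-! ### Encoding a pair of matrices by relations on pairs of vectors. -/

section Scheme

variable (F : Type u) [Field F]

/-- The labels of the binary relations used to encode a pair of matrices. -/
abbrev RowLabel : Type u := Fin 3 ⊕ Fin 2 ⊕ F

variable {F}

/-- The rows of the block matrix: `x₂ - y₂`, `x₁ - y₂`, `x₁ + x₂ - y₁`, `A x₁ - y₁`, `B x₁ - y₁` and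
`c x₁ - y₁` for scalars `c`. -/
noncomputable def rowPolynomials : RowLabel F → Fin 2 ⊕ Fin 2 → FreeAlgebra F (Fin 2)
  | .inl i => ![Sum.elim ![0, 1] ![0, -1], Sum.elim ![1, 0] ![0, -1], Sum.elim ![1, 1] ![-1, 0]] i
  | .inr (.inl i) => Sum.elim ![FreeAlgebra.ι F i, 0] ![-1, 0]
  | .inr (.inr c) => Sum.elim ![algebraMap F _ c, 0] ![-1, 0]

namespace MatrixPair

variable (P : MatrixPair F)

/-- The binary relation on pairs of vectors that is expressed by a row. -/
def rowRel (P : MatrixPair F) (x y : Fin 2 → Fin P.n → F) : RowLabel F → Prop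
  | .inl i => ![x 1 = y 1, x 0 = y 1, x 0 + x 1 = y 0] i
  | .inr (.inl i) => (![P.A, P.B] i).mulVec (x 0) = y 0
  | .inr (.inr c) => c • x 0 = y 0

theorem eval_rowPolynomials_eq_zero_iff (x y : Fin 2 → Fin P.n → F) (l : RowLabel F) :
    ∑ c, (P.eval (rowPolynomials l c)).mulVec (Sum.elim x y c) = 0 ↔ P.rowRel x y l := by
  have h0 : P.eval 0 = 0 := map_zero _
  have h1 : P.eval 1 = 1 := map_one _
  have hn : P.eval (-1) = -1 := by rw [← h1]; exact map_neg _ _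
  have hι : ∀ i, P.eval (FreeAlgebra.ι F i) = ![P.A, P.B] i := fun i =>
    FreeAlgebra.lift_ι_apply _ _
  have hc : ∀ c, P.eval (algebraMap F _ c) = c • 1 := fun c =>
    (AlgHom.commutes _ c).trans (Algebra.algebraMap_eq_smul_one c)
  rcases l with i | i | c
  · fin_cases i <;>
      simp [rowPolynomials, rowRel, Fintype.sum_sum_type, h0, h1, hn, Matrix.neg_mulVec,
        ← sub_eq_add_neg, sub_eq_zero]
  · simp [rowPolynomials, rowRel, Fintype.sum_sum_type, h0, hn, hι, Matrix.neg_mulVec,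
      ← sub_eq_add_neg, sub_eq_zero]
  · simp [rowPolynomials, rowRel, Fintype.sum_sum_type, h0, hn, hc, Matrix.neg_mulVec,
      Matrix.smul_mulVec, ← sub_eq_add_neg, sub_eq_zero]

theorem eq_iff_rowRel (x y : Fin 2 → Fin P.n → F) :
    x = y ↔ P.rowRel x y (.inl 0) ∧ P.rowRel x y (.inr (.inr 1)) := by
  simp [rowRel, funext_iff (f := x), and_comm]

variable {P} {Q : MatrixPair F}

theorem similar_of_n_eq_zero (hP : P.n = 0) (hQ : Q.n = 0) : P.Similar Q := by
  have : IsEmpty (Fin P.n) := hP ▸ Fin.isEmpty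
  have : IsEmpty (Fin Q.n) := hQ ▸ Fin.isEmpty
  exact ⟨0, 0, Subsingleton.elim _ _, Subsingleton.elim _ _, Subsingleton.elim _ _,
    Subsingleton.elim _ _⟩

theorem similar_of_linearEquiv (L : (Fin P.n → F) ≃ₗ[F] (Fin Q.n → F))
    (hA : ∀ a, L (P.A.mulVec a) = Q.A.mulVec (L a))
    (hB : ∀ a, L (P.B.mulVec a) = Q.B.mulVec (L a)) : P.Similar Q := by
  have key : ∀ (X : Matrix (Fin P.n) (Fin P.n) F) (Y : Matrix (Fin Q.n) (Fin Q.n) F),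
      (∀ a, L (X.mulVec a) = Y.mulVec (L a)) →
      Y = LinearMap.toMatrix' (L : (Fin P.n → F) →ₗ[F] (Fin Q.n → F)) * X *
        LinearMap.toMatrix' (L.symm : (Fin Q.n → F) →ₗ[F] (Fin P.n → F)) := by
    intro X Y h
    apply Matrix.toLin'.injective
    ext1 i
    refine LinearMap.ext fun t => ?_
    simp [Matrix.toLin'_mul, h]
  refine ⟨LinearMap.toMatrix' (L : (Fin P.n → F) →ₗ[F] (Fin Q.n → F)),
    LinearMap.toMatrix' (L.symm : (Fin Q.n → F) →ₗ[F] (Fin P.n → F)), ?_, ?_,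
    key _ _ hA, key _ _ hB⟩
  · rw [← LinearMap.toMatrix'_comp, LinearEquiv.comp_symm, LinearMap.toMatrix'_id]
  · rw [← LinearMap.toMatrix'_comp, LinearEquiv.symm_comp, LinearMap.toMatrix'_id]

/-- The relation with scalar 1 makes the first component of `f x` depend only on `x 0`, through a
map `g`, and the mixed relation `x 0 = y 1` makes the second component the same `g` of `x 1`. The
remaining relations make `g` additive, homogeneous over all of `F` and compatible with both
matrices. -/
theorem similar_of_equiv (f : (Fin 2 → Fin P.n → F) ≃ (Fin 2 → Fin Q.n → F))
    (hf : ∀ l x y, P.rowRel x y l ↔ Q.rowRel (f x) (f y) l) : P.Similar Q := by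
  have hfst : ∀ x y, x 0 = y 0 ↔ f x 0 = f y 0 := fun x y => by
    simpa [rowRel] using hf (.inr (.inr 1)) x y
  have hmix : ∀ x y, x 0 = y 1 ↔ f x 0 = f y 1 := hf (.inl 1)
  have hadd : ∀ x y, x 0 + x 1 = y 0 ↔ f x 0 + f x 1 = f y 0 := hf (.inl 2)
  have hgen : ∀ i x y, (![P.A, P.B] i).mulVec (x 0) = y 0 ↔
      (![Q.A, Q.B] i).mulVec (f x 0) = f y 0 := fun i => hf (.inr (.inl i))
  have hsmul : ∀ (c : F) x y, c • x 0 = y 0 ↔ c • f x 0 = f y 0 := fun c => hf (.inr (.inr c))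
  let g : (Fin P.n → F) → (Fin Q.n → F) := fun a => f ![a, a] 0
  have hg0 : ∀ x, f x 0 = g (x 0) := fun x => (hfst _ _).1 rfl
  have hg1 : ∀ x, f x 1 = g (x 1) := fun x => ((hmix _ _).1 rfl).symm
  have hgadd : ∀ a b, g (a + b) = g a + g b := by
    intro a b
    have := (hadd ![a, b] ![a + b, 0]).1 rfl
    rw [hg0, hg1, hg0] at this
    exact this.symm
  have hgsmul : ∀ (c : F) a, g (c • a) = c • g a := by
    intro c a
    have := (hsmul c ![a, 0] ![c • a, 0]).1 rfl
    rw [hg0, hg0] at this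
    exact this.symm
  have hggen : ∀ i a, g ((![P.A, P.B] i).mulVec a) = (![Q.A, Q.B] i).mulVec (g a) := by
    intro i a
    have := (hgen i ![a, 0] ![(![P.A, P.B] i).mulVec a, 0]).1 rfl
    rw [hg0, hg0] at this
    exact this.symm
  have hbij : Function.Bijective g := by
    refine ⟨fun a b h => (hfst ![a, a] ![b, b]).2 h, fun b => ?_⟩
    obtain ⟨x, hx⟩ := f.surjective ![b, b]
    exact ⟨x 0, by rw [← hg0, hx]; rfl⟩
  let L : (Fin P.n → F) →ₗ[F] (Fin Q.n → F) :=
    { toFun := g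
      map_add' := hgadd
      map_smul' := hgsmul }
  exact similar_of_linearEquiv (LinearEquiv.ofBijective L hbij) (hggen 0) (hggen 1)

theorem Similar.exists_equiv (h : P.Similar Q) :
    ∃ f : (Fin 2 → Fin P.n → F) ≃ (Fin 2 → Fin Q.n → F),
      ∀ l x y, P.rowRel x y l ↔ Q.rowRel (f x) (f y) l := by
  obtain ⟨S, S', hSS', hS'S, hA, hB⟩ := h
  let g : (Fin P.n → F) ≃ (Fin Q.n → F) :=
    { toFun := S.mulVec
      invFun := S'.mulVec
      left_inv := fun a => by rw [Matrix.mulVec_mulVec, hS'S, Matrix.one_mulVec]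
      right_inv := fun a => by rw [Matrix.mulVec_mulVec, hSS', Matrix.one_mulVec] }
  have hgadd : ∀ a b, g a + g b = g (a + b) := fun a b => (S.mulVec_add a b).symm
  have hgsmul : ∀ (c : F) a, c • g a = g (c • a) := fun c a => (S.mulVec_smul c a).symm
  have key : ∀ (X : Matrix (Fin P.n) (Fin P.n) F) (Y : Matrix (Fin Q.n) (Fin Q.n) F),
      Y = S * X * S' → ∀ a, Y.mulVec (g a) = g (X.mulVec a) := by
    rintro X Y rfl a
    change (S * X * S').mulVec (S.mulVec a) = S.mulVec (X.mulVec a)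
    rw [Matrix.mulVec_mulVec, Matrix.mul_assoc, hS'S, Matrix.mul_one, Matrix.mulVec_mulVec]
  refine ⟨Equiv.piCongrRight fun _ => g, ?_⟩
  rintro (i | i | c) x y
  · fin_cases i <;> simp [rowRel, hgadd]
  · fin_cases i
    · simp [rowRel, key _ _ hA]
    · simp [rowRel, key _ _ hB]
  · simp [rowRel, hgsmul]

end MatrixPair

namespace GraphScheme

variable (F) [Finite F]

/-- The number of relations. -/
noncomputable def rowCount : ℕ := Nat.card (RowLabel F)

/-- The enumeration of the relations. -/
noncomputable def rowEquiv : RowLabel F ≃ Fin (rowCount F) := Finite.equivFin _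

/-- The uniform construction of layered graphs from pairs of matrices. -/
noncomputable def layeredScheme : GraphScheme F where
  t := (rowCount F + 2) + (rowCount F + 2)
  k := 2
  r := rowCount F
  T := fun j => rowPolynomials ((rowEquiv F).symm j)
  -- The rule sees only `J`, so equality of the two tuples is read off from the rows for `x 1 = y 1`
  -- and `1 • x 0 = y 0`.
  adj := fun s s' J => SimpleGraph.layerRule
    (rowEquiv F (.inl 0) ∈ J ∧ rowEquiv F (.inr (.inr 1)) ∈ J) (· ∈ J)
    (finSumFinEquiv.symm s) (finSumFinEquiv.symm s')

variable {F}

theorem layeredScheme_iso (P : MatrixPair F) :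
    Nonempty (((layeredScheme F).graph P).graph ≃g
      SimpleGraph.layered fun i x y => P.rowRel x y ((rowEquiv F).symm i)) := by
  have hmem' : ∀ x y i, P.rowRel x y ((rowEquiv F).symm i) ↔
      i ∈ (layeredScheme F).vanishing P x y := fun x y i =>
    (P.eval_rowPolynomials_eq_zero_iff x y _).symm
  have hmem : ∀ x y l, P.rowRel x y l ↔
      rowEquiv F l ∈ (layeredScheme F).vanishing P x y := fun x y l => by
    have h := hmem' x y (rowEquiv F l)
    rwa [Equiv.symm_apply_apply] at h
  have h : ∀ v w : (layeredScheme F).Vertex P.n,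
      SimpleGraph.layerRule (v.2 = w.2) (fun i => P.rowRel v.2 w.2 ((rowEquiv F).symm i))
        (finSumFinEquiv.symm v.1) (finSumFinEquiv.symm w.1) ↔
      (layeredScheme F).adj v.1 w.1 ((layeredScheme F).vanishing P v.2 w.2) := fun v w =>
    SimpleGraph.layerRule_congr
      ((P.eq_iff_rowRel v.2 w.2).trans (and_congr (hmem _ _ _) (hmem _ _ _))) (hmem' _ _) _ _
  let e : (layeredScheme F).Vertex P.n ≃
      SimpleGraph.LayerColor (rowCount F) × (Fin 2 → Fin P.n → F) :=
    finSumFinEquiv.symm.prodCongr (Equiv.refl _)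
  refine ⟨⟨e, @fun v w => ?_⟩⟩
  exact (SimpleGraph.fromRel_adj _ _ _).trans
    ((and_congr e.injective.ne_iff (or_congr (h v w) (h w v))).trans
      (SimpleGraph.fromRel_adj (fun v w : (layeredScheme F).Vertex P.n =>
        (layeredScheme F).adj v.1 w.1 ((layeredScheme F).vanishing P v.2 w.2)) v w).symm)

theorem layeredScheme_noAdjTwins (P : MatrixPair F) :
    ((layeredScheme F).graph P).graph.NoAdjTwins := by
  obtain ⟨e⟩ := layeredScheme_iso P
  intro j l h
  obtain ⟨m, hj, hl, hm⟩ := SimpleGraph.layered_noAdjTwins _ (e j) (e l) (e.map_adj_iff.2 h)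
  obtain ⟨m, rfl⟩ := e.surjective m
  rw [e.map_adj_iff, e.map_adj_iff] at hm
  exact ⟨m, fun h => hj (h ▸ rfl), fun h => hl (h ▸ rfl), hm⟩

theorem similar_iff_graphIso (P Q : MatrixPair F) :
    P.Similar Q ↔ FinGraph.GraphIso ((layeredScheme F).graph P) ((layeredScheme F).graph Q) := by
  obtain ⟨eP⟩ := layeredScheme_iso P
  obtain ⟨eQ⟩ := layeredScheme_iso Q
  constructor
  · intro h
    obtain ⟨f, hf⟩ := h.exists_equiv
    obtain ⟨e⟩ := SimpleGraph.layered_iso_of_equiv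
      (R := fun i x y => P.rowRel x y ((rowEquiv F).symm i))
      (R' := fun i x y => Q.rowRel x y ((rowEquiv F).symm i)) f
      fun i x y => hf ((rowEquiv F).symm i) x y
    exact ⟨(eP.trans e).trans eQ.symm⟩
  · rintro ⟨e⟩
    have θ := (eP.symm.trans e).trans eQ
    have hcard := SimpleGraph.card_eq_of_layered_iso θ
    have hn : ∀ P : MatrixPair F, P.n ≠ 0 → Nontrivial (Fin 2 → Fin P.n → F) := fun P hP => by
      have : NeZero P.n := ⟨hP⟩
      infer_instance
    have h0 : ∀ P : MatrixPair F, P.n = 0 → Subsingleton (Fin 2 → Fin P.n → F) := fun P hP => by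
      have : IsEmpty (Fin P.n) := hP ▸ Fin.isEmpty
      infer_instance
    -- In size zero there is a single tuple and markers cannot be recognized by twins; the number of
    -- tuples then shows that both sizes are zero.
    by_cases hP : P.n = 0
    · by_cases hQ : Q.n = 0
      · exact MatrixPair.similar_of_n_eq_zero hP hQ
      · have := hn Q hQ
        exact absurd hcard (Finite.card_le_one_iff_subsingleton.2 (h0 P hP) |>.trans_lt
          Finite.one_lt_card).ne
    · by_cases hQ : Q.n = 0
      · have := hn P hP
        exact absurd hcard (Finite.card_le_one_iff_subsingleton.2 (h0 Q hQ) |>.trans_lt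
          Finite.one_lt_card).ne'
      · have := hn P hP
        have := hn Q hQ
        obtain ⟨f, hf⟩ := SimpleGraph.exists_equiv_of_layered_iso θ
        refine MatrixPair.similar_of_equiv f fun l x y => ?_
        simpa using hf (rowEquiv F l) x y

end GraphScheme

end Scheme

theorem theorem6 (p : ℕ) (hp : p.Prime) (hp2 : p ≠ 2) (F : Type u) [Field F] [Finite F] :
    IsWild F FinGraph.GraphIso ∧
      IsWild F (FinGraph.HAlgebraIso p) ∧
      IsWild F (FinGraph.HGroupIso p) := by
  refine ⟨⟨GraphScheme.layeredScheme F, GraphScheme.similar_iff_graphIso⟩,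
    ⟨GraphScheme.layeredScheme F, fun P Q => ?_⟩, ⟨GraphScheme.layeredScheme F, fun P Q => ?_⟩⟩
  · rw [GraphScheme.similar_iff_graphIso]
    exact ⟨fun h => h.hAlgebraIso, fun h => h.graphIso hp
      (GraphScheme.layeredScheme_noAdjTwins Q)⟩
  · rw [GraphScheme.similar_iff_graphIso]
    exact ⟨fun h => h.hGroupIso, fun h => h.graphIso hp hp2
      (GraphScheme.layeredScheme_noAdjTwins Q)⟩
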